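/- Quicksort with errors sorts a list of distinct elements as follows: the first element of the list is the pivot; every other element is compared with the pivot, and each such comparison independently gives the wrong answer with probability $p$; the elements reported as smaller (resp. larger) than the pivot form a list that is placed on its left (resp. right); both sublists are then treated recursively in the same way, with new independent errors. Let $I(n,p)$ be the number of inversions (pairs $i<j$ with $y_i>y_j$) of the output $(y_1,\dots,y_n)$ when the input is a uniformly random ordering of $n$ distinct elements, and put $X_{n,p}=I(n,p)/(n^2p)$. Let $c\in(0,1]$. The equation $$X_c\overset{\text{law}}{=}[(1-2c)U+c]^2X_c+[(2c-1)U+1-c]^2\widetilde X_c+T(c,U),\qquad T(c,U)=\frac{1-c}{2}\bigl(U^2+(1-U)^2\bigr)+cU(1-U),$$ in which $U$ is uniform on $[0,1]$, $\widetilde X_c$ has the same law as $X_c$, and $X_c,\widetilde X_c,U$ are independent, has exactly one solution (a probability law on $\mathbb R$) with finite mean. If $n\to\infty$ and $p\to c$, with $p\in[0,1]$ (that is, for every neighbourhood of the limit there are $N$ and $\varepsilon>0$ that work for all $n\ge N$ and all $p\in[0,1]$ with $|p-c|\le\varepsilon$), then $X_{n,p}$ converges to $X_c$ in distribution and in the Wasserstein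 metric $d_1(\mu,\nu)=\inf\{\mathbb E|X-Y|:\mathcal L(X)=\mu,\ \mathcal L(Y)=\nu\}$. Furthermore $X_c$ has a finite second moment, $$\mathbb E X_c=\frac{2-c}{2(1+2c-2c^2)},\qquad \operatorname{Var}X_c=\frac{(1-c)^2(1-2c)^2}{4(1+2c-2c^2)^2(3+6c-8c^2+4c^3-2c^4)}.$$ -/

import Mathlib

open MeasureTheory ProbabilityTheory Filter Topology

namespace NoisyQuicksort

noncomputable section

/-- A coin which shows `true` (an erroneous comparison) with probability `p`. -/
def errorCoin (p : unitInterval) : PMF Bool :=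
  (bernoulliMeasure true false p).toPMF

/-- The first step of Quicksort with errors.  Every element `x` of the list is compared with the
pivot `a`; each answer to the question `x < a` is independently wrong with probability `p`. The
elements which are reported to be smaller go to the left sublist, the others to the right one. -/
def errorPartition {α : Type*} [LinearOrder α] (p : unitInterval) (a : α) :
    List α → PMF (List α × List α)
  | [] => PMF.pure ([], [])
  | x :: l => (errorCoin p).bind fun err => (errorPartition p a l).map fun q =>
      if xor (decide (x < a)) err then (x :: q.1, q.2) else (q.1, x :: q.2)

theorem length_of_mem_support_errorPartition {α : Type*} [LinearOrder α] (p : unitInterval)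
    (a : α) (l : List α) (q : List α × List α) (hq : q ∈ (errorPartition p a l).support) :
    q.1.length + q.2.length = l.length := by
  induction l generalizing q with
  | nil =>
    simp only [errorPartition, PMF.mem_support_pure_iff] at hq
    simp [hq]
  | cons x l ih =>
    simp only [errorPartition, PMF.mem_support_bind_iff, PMF.mem_support_map_iff] at hq
    obtain ⟨err, -, q', hq', rfl⟩ := hq
    have h := ih q' hq'
    split_ifs <;> simp only [List.length_cons] <;> omega

/-- Quicksort with errors: the first element of the list is the pivot, the rest is split by
comparisons that are independently wrong with probability `p`, and the two sublists are treated
recursively and independently.  The value is the law of the output list.  (`bindOnSupport` is the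
usual `bind`, see `quicksort_cons`; it records that the sublists are shorter.) -/
def quicksort {α : Type*} [LinearOrder α] (p : unitInterval) : List α → PMF (List α)
  | [] => PMF.pure []
  | a :: l => (errorPartition p a l).bindOnSupport fun q hq =>
      have _h := length_of_mem_support_errorPartition p a l q hq
      (quicksort p q.1).bind fun y => (quicksort p q.2).map fun z => y ++ a :: z
termination_by l => l.length
decreasing_by
  · simp only [List.length_cons]; omega
  · simp only [List.length_cons]; omega

theorem quicksort_nil {α : Type*} [LinearOrder α] (p : unitInterval) :
    quicksort p ([] : List α) = PMF.pure [] := by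
  rw [quicksort]

theorem quicksort_cons {α : Type*} [LinearOrder α] (p : unitInterval) (a : α) (l : List α) :
    quicksort p (a :: l) = (errorPartition p a l).bind fun q =>
      (quicksort p q.1).bind fun y => (quicksort p q.2).map fun z => y ++ a :: z := by
  rw [quicksort]
  exact PMF.bindOnSupport_eq_bind _ _

/-- The number of inversions of a list: pairs of positions `i < j` with `y i > y j`. -/
def inversions {α : Type*} [LinearOrder α] (y : List α) : ℕ :=
  (Finset.univ.filter fun ij : Fin y.length × Fin y.length =>
    ij.1 < ij.2 ∧ y.get ij.2 < y.get ij.1).card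

/-- The law of `I(n, p)`, the number of inversions in the output of Quicksort with errors on a
uniformly random order of `n` distinct elements. -/
def inversionsLaw (n : ℕ) (p : unitInterval) : PMF ℕ :=
  (PMF.uniformOfFintype (Equiv.Perm (Fin n))).bind fun σ =>
    (quicksort p (List.ofFn σ)).map inversions

/-- The law of `X_{n,p} = I(n, p) / (n ^ 2 * p)`. -/
def scaledLaw (n : ℕ) (p : unitInterval) : ProbabilityMeasure ℝ :=
  ⟨((inversionsLaw n p).map fun k : ℕ => (k : ℝ) / ((n : ℝ) ^ 2 * (p : ℝ))).toMeasure,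
    inferInstance⟩

/-- The Wasserstein distance `d₁`: the infimum of `E |X - Y|` over all couplings `π`. -/
def wassersteinDist (μ ν : Measure ℝ) : ENNReal :=
  ⨅ π : {π : Measure (ℝ × ℝ) // π.map Prod.fst = μ ∧ π.map Prod.snd = ν},
    ∫⁻ z, ENNReal.ofReal |z.1 - z.2| ∂π.1

/-- The toll function `T(c, u)`. -/
def toll (c u : ℝ) : ℝ := (1 - c) / 2 * (u ^ 2 + (1 - u) ^ 2) + c * (u * (1 - u))

/-- The law of `[(1 - 2c) U + c]² X + [(2c - 1) U + 1 - c]² X' + T(c, U)`, where `X`, `X'`, `U` are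
independent, `X` and `X'` have law `μ`, and `U` is uniform on `[0, 1]`. -/
def recursionLaw (c : ℝ) (μ : Measure ℝ) : Measure ℝ :=
  (μ.prod (μ.prod (volume.restrict (Set.Icc (0 : ℝ) 1)))).map fun w =>
    ((1 - 2 * c) * w.2.2 + c) ^ 2 * w.1 + ((2 * c - 1) * w.2.2 + 1 - c) ^ 2 * w.2.1 + toll c w.2.2

/-- `μ` has finite mean and solves the distributional equation with parameter `c`. -/
def IsFiniteMeanSolution (c : ℝ) (μ : ProbabilityMeasure ℝ) : Prop :=
  Integrable (fun x : ℝ => x) (μ : Measure ℝ) ∧ recursionLaw c (μ : Measure ℝ) = (μ : Measure ℝ)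

end

end NoisyQuicksort

/-!
The theorem rests on a coupling argument for the metric `d₁`, together with a bound for the
fluctuations in one partition step.

*The recursion.* If the input is in random order, then the pivot has a uniformly distributed rank
`s`. The errors are independent of the order of the other elements, and when the errors are fixed
the two sublists are obtained by distributing the elements of a random ordering onto two lists, so
they are independent and again randomly ordered (`orderings_map_filter`). Only relative order
matters. Hence the number of inversions is `I_Z + I'_{n - Z} + toll`, where `Z` is the size of the
left sublist and the toll counts the inversions made by the partition (`inversionsLaw_succ`).

*Concentration.* When the elements are read in decreasing order, `Z` and the number `C` of
inversions between the two sublists form a Markov chain. For `n` elements its variances are at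
most `n` and `n ^ 3` (`chainMean_fst_sq_le`, `chainMean_snd_sq_le`). With `u = s / n` the means
are about `n * ((1 - 2p) u + p)` and `n ^ 2 * p * T(p, u)`, so that after scaling by `n ^ 2 * p`
the recursion differs from the distributional equation by `O(1 / √n + |p - c|)`.

*Contraction.* The coefficients satisfy
`[(1 - 2c) u + c] ^ 2 + [(2c - 1) u + 1 - c] ^ 2 ≤ u ^ 2 + (1 - u) ^ 2`, which has mean `2 / 3`.
So couplings of the ingredients with cost `r` yield a coupling of the right hand sides of the
equation with cost `2 / 3 * r` (`CoupledWithin.recursionLaw`). This gives uniqueness among the laws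
with finite mean. For existence, the laws on `[0, 2 / c]` are weakly compact and preserved by the
equation. The iterates which start at `δ₀` have a convergent subsequence, and its limit is a fixed
point, since consecutive iterates approach each other (`exists_solution`). A fixed point supported
in `[0, 2 / c]` has all moments, and the equation gives its mean and variance by integrating
polynomials.

*Convergence.* The scaled laws have bounded distance from the solution, as all of these laws live
on `[0, 2 / c]` for `p ≥ c / 2`. If they are eventually coupled with cost `a`, then the recursion
couples them with cost `2 / 3 * a + o(1)`, because sublists of bounded size have vanishing weight
(`coupledWithin_scaledLaw_succ`). Iteration yields couplings with arbitrarily small cost, hence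
convergence in `d₁` and in distribution (`eventually_coupledWithin`).
-/

namespace NoisyQuicksort

/-! ### Uniformly random orderings of a list -/

theorem bind_congr_of_mem_support {α β : Type*} (P : PMF α) (f g : α → PMF β)
    (h : ∀ a ∈ P.support, f a = g a) : P.bind f = P.bind g := by
  ext b
  rw [PMF.bind_apply, PMF.bind_apply]
  refine tsum_congr fun a => ?_
  by_cases ha : a ∈ P.support
  · rw [h a ha]
  · rw [PMF.apply_eq_zero_iff P a |>.2 ha, zero_mul, zero_mul]

/-- A map all of whose fibres have the same size carries the uniform law to the uniform law. -/
theorem map_uniformOfFinset {α β : Type*} [DecidableEq β] {s : Finset α} {t : Finset β}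
    (hs : s.Nonempty) (ht : t.Nonempty) (f : α → β) (m : ℕ) (hf : ∀ x ∈ s, f x ∈ t)
    (hm : ∀ y ∈ t, (s.filter fun x => f x = y).card = m) :
    (PMF.uniformOfFinset s hs).map f = PMF.uniformOfFinset t ht := by
  classical
  have hcard : s.card = t.card * m := by
    rw [Finset.card_eq_sum_card_fiberwise (f := f) (t := t) hf, Finset.sum_congr rfl hm,
      Finset.sum_const, smul_eq_mul]
  have hm0 : m ≠ 0 := by
    rintro rfl
    simp [hs.card_pos.ne'] at hcard
  ext y
  rw [← PMF.toOuterMeasure_apply_singleton, PMF.toOuterMeasure_map_apply,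
    PMF.toOuterMeasure_uniformOfFinset_apply, PMF.uniformOfFinset_apply]
  simp only [Set.mem_preimage, Set.mem_singleton_iff]
  split_ifs with hy
  · rw [hm y hy, hcard, Nat.cast_mul, ENNReal.div_eq_inv_mul,
      ENNReal.mul_inv (Or.inr (by simp)) (Or.inl (by simp)), mul_assoc,
      ENNReal.inv_mul_cancel (by exact_mod_cast hm0) (by simp), mul_one]
  · have : s.filter (fun x => f x = y) = ∅ := by
      rw [Finset.filter_eq_empty_iff]
      rintro x hx rfl
      exact hy (hf x hx)
    simp [this]

noncomputable section

variable {α β : Type*} [DecidableEq α] [DecidableEq β]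

theorem permutations_toFinset_nonempty (l : List α) : l.permutations.toFinset.Nonempty :=
  ⟨l, by simp⟩

/-- The uniform law on the rearrangements of a list. -/
def orderings (l : List α) : PMF (List α) :=
  PMF.uniformOfFinset l.permutations.toFinset (permutations_toFinset_nonempty l)

theorem mem_support_orderings {l m : List α} : m ∈ (orderings l).support ↔ m.Perm l := by
  rw [orderings, PMF.mem_support_uniformOfFinset_iff, List.mem_toFinset, List.mem_permutations]

theorem card_permutations_toFinset {l : List α} (hl : l.Nodup) :
    l.permutations.toFinset.card = l.length.factorial := by
  rw [List.toFinset_card_of_nodup (List.nodup_permutations l hl), List.length_permutations]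

theorem orderings_apply {l : List α} (hl : l.Nodup) (m : List α) :
    orderings l m = if m.Perm l then (l.length.factorial : ENNReal)⁻¹ else 0 := by
  rw [orderings, PMF.uniformOfFinset_apply, card_permutations_toFinset hl]
  simp only [List.mem_toFinset, List.mem_permutations]

theorem orderings_map {l : List α} (f : α → β) (hf : Function.Injective f) :
    orderings (l.map f) = (orderings l).map (List.map f) := by
  symm
  refine map_uniformOfFinset _ _ _ 1 ?_ ?_
  · intro m hm
    simp only [List.mem_toFinset, List.mem_permutations] at hm ⊢
    exact hm.map f
  · intro y hy
    rw [List.mem_toFinset, ← List.map_permutations, List.mem_map] at hy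
    obtain ⟨m, hm, rfl⟩ := hy
    rw [List.mem_permutations] at hm
    rw [Finset.card_eq_one]
    refine ⟨m, ?_⟩
    ext z
    simp only [Finset.mem_filter, List.mem_toFinset, List.mem_permutations,
      Finset.mem_singleton]
    constructor
    · rintro ⟨-, h⟩
      exact hf.list_map h
    · rintro rfl
      exact ⟨hm, rfl⟩

theorem map_ofFn_uniformOfFintype (n : ℕ) :
    (PMF.uniformOfFintype (Equiv.Perm (Fin n))).map (fun σ : Equiv.Perm (Fin n) => List.ofFn σ) =
      orderings (List.finRange n) := by
  refine map_uniformOfFinset _ _ _ 1 ?_ ?_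
  · intro σ _
    simp only [List.mem_toFinset, List.mem_permutations]
    rw [List.perm_ext_iff_of_nodup (List.nodup_ofFn.2 σ.injective) (List.nodup_finRange n)]
    intro a
    simpa [List.mem_ofFn] using σ.surjective a
  · intro y hy
    simp only [List.mem_toFinset, List.mem_permutations] at hy
    have hlen : y.length = n := by simpa using hy.length_eq
    have hnd : y.Nodup := hy.nodup_iff.2 (List.nodup_finRange n)
    have hget : List.ofFn (fun i : Fin n => y.get (Fin.cast hlen.symm i)) = y :=
      List.ext_getElem (by simp [hlen]) (by simp)
    have hinj : Function.Injective fun i : Fin n => y.get (Fin.cast hlen.symm i) :=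
      (List.nodup_iff_injective_get.1 hnd).comp (Fin.cast_injective _)
    rw [Finset.card_eq_one]
    refine ⟨Equiv.ofBijective _ (Finite.injective_iff_bijective.1 hinj), ?_⟩
    ext σ
    simp only [Finset.mem_filter, Finset.mem_univ, true_and, Finset.mem_singleton]
    constructor
    · intro h
      ext i
      have := List.ofFn_injective (h.trans hget.symm)
      simp [this]
    · rintro rfl
      exact hget

theorem map_cons_apply (P : PMF (List α)) (a b : α) (t : List α) :
    P.map (List.cons a) (b :: t) = if b = a then P t else 0 := by
  rw [PMF.map_apply]
  split_ifs with h
  · subst h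
    rw [tsum_eq_single t]
    · simp
    · intro t' ht'
      simp [ht'.symm]
  · simp [h]

/-- A uniformly random ordering is a uniformly random first element followed by a uniformly random
ordering of the others. -/
theorem orderings_finRange_succ (n : ℕ) :
    orderings (List.finRange (n + 1)) = (PMF.uniformOfFintype (Fin (n + 1))).bind fun s =>
      (orderings ((List.finRange (n + 1)).erase s)).map (List.cons s) := by
  have hnd := List.nodup_finRange (n + 1)
  ext m
  rw [orderings_apply hnd, PMF.bind_apply]
  cases m with
  | nil =>
    rw [if_neg (fun h => by simpa using h.length_eq), eq_comm, ENNReal.tsum_eq_zero]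
    intro s
    simp [PMF.map_apply]
  | cons b t =>
    simp only [map_cons_apply, mul_ite, mul_zero]
    rw [tsum_eq_single b fun s hs => if_neg hs.symm, if_pos rfl, orderings_apply (hnd.erase b),
      List.length_erase_of_mem (List.mem_finRange b), List.length_finRange, Nat.add_sub_cancel,
      PMF.uniformOfFintype_apply, Fintype.card_fin]
    have hiff : (b :: t).Perm (List.finRange (n + 1)) ↔
        t.Perm ((List.finRange (n + 1)).erase b) := by
      rw [← List.perm_cons b (l₂ := (List.finRange (n + 1)).erase b)]
      have := List.perm_cons_erase (List.mem_finRange b)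
      exact ⟨fun h => h.trans this, fun h => h.trans this.symm⟩
    simp only [hiff, mul_ite, mul_zero, Nat.factorial_succ, Nat.cast_mul]
    rw [ENNReal.mul_inv (Or.inr (by simp)) (Or.inl (by simp))]

/-- All the ways to merge two lists. -/
def shuffles : List α → List α → Finset (List α)
  | [], l => {l}
  | a :: l, [] => {a :: l}
  | a :: l, b :: m =>
    (shuffles l (b :: m)).image (List.cons a) ∪ (shuffles (a :: l) m).image (List.cons b)
termination_by l m => l.length + m.length

/-- If `P` separates `l` from `m`, then the shuffles of `l` and `m` are the lists
which `P` splits into `l` and `m`. -/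
theorem mem_shuffles (P : α → Bool) (l m : List α) (hl : ∀ x ∈ l, P x = true)
    (hm : ∀ x ∈ m, P x = false) (q : List α) :
    q ∈ shuffles l m ↔ q.filter P = l ∧ q.filter (fun x => !P x) = m := by
  fun_induction shuffles l m generalizing q with
  | case1 l =>
    rw [Finset.mem_singleton]
    constructor
    · rintro rfl
      rw [List.filter_eq_nil_iff, List.filter_eq_self]
      exact ⟨fun a ha => by simp [hm a ha], fun a ha => by simp [hm a ha]⟩
    · rintro ⟨h1, h2⟩
      rw [← h2, eq_comm, List.filter_eq_self]
      rw [List.filter_eq_nil_iff] at h1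
      exact fun a ha => by simpa using h1 a ha
  | case2 a l =>
    rw [Finset.mem_singleton]
    constructor
    · rintro rfl
      rw [List.filter_eq_nil_iff, List.filter_eq_self]
      exact ⟨fun a ha => by simp [hl a ha], fun a ha => by simp [hl a ha]⟩
    · rintro ⟨h1, h2⟩
      rw [← h1, eq_comm, List.filter_eq_self]
      rw [List.filter_eq_nil_iff] at h2
      exact fun a ha => by simpa using h2 a ha
  | case3 a l b m ih1 ih2 =>
    have ha : P a = true := hl a (by simp)
    have hb : P b = false := hm b (by simp)
    have ih1' := ih1 (fun x hx => hl x (by simp [hx])) hm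
    have ih2' := ih2 hl (fun x hx => hm x (by simp [hx]))
    simp only [Finset.mem_union, Finset.mem_image]
    constructor
    · rintro (⟨q', hq', rfl⟩ | ⟨q', hq', rfl⟩)
      · rw [ih1'] at hq'
        simp [ha, hq'.1, hq'.2]
      · rw [ih2'] at hq'
        simp [hb, hq'.1, hq'.2]
    · rintro ⟨h1, h2⟩
      cases q with
      | nil => simp at h1
      | cons x q =>
        by_cases hx : P x = true
        · simp only [List.filter_cons, hx, if_true, List.cons.injEq] at h1
          simp only [List.filter_cons, hx] at h2
          left
          exact ⟨q, (ih1' q).2 ⟨h1.2, by simpa using h2⟩, by rw [h1.1]⟩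
        · simp only [Bool.not_eq_true] at hx
          simp only [List.filter_cons, hx] at h1
          simp only [List.filter_cons, hx, Bool.not_false, if_true, List.cons.injEq] at h2
          right
          exact ⟨q, (ih2' q).2 ⟨by simpa using h1, h2.2⟩, by rw [h2.1]⟩

theorem card_shuffles (P : α → Bool) (l m : List α) (hl : ∀ x ∈ l, P x = true)
    (hm : ∀ x ∈ m, P x = false) :
    (shuffles l m).card = (l.length + m.length).choose l.length := by
  fun_induction shuffles l m with
  | case1 l => simp
  | case2 a l => simp
  | case3 a l b m ih1 ih2 =>
    have ha : P a = true := hl a (by simp)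
    have hb : P b = false := hm b (by simp)
    rw [Finset.card_union_of_disjoint, Finset.card_image_of_injective _ List.cons_injective,
      Finset.card_image_of_injective _ List.cons_injective,
      ih1 (fun x hx => hl x (by simp [hx])) hm, ih2 hl (fun x hx => hm x (by simp [hx]))]
    · simp only [List.length_cons]
      rw [show l.length + 1 + (m.length + 1) = (l.length + (m.length + 1)) + 1 by ring,
        Nat.choose_succ_succ, show l.length + 1 + m.length = l.length + (m.length + 1) by ring]
    · rw [Finset.disjoint_left]
      intro q hq hq'
      simp only [Finset.mem_image] at hq hq'
      obtain ⟨_, -, rfl⟩ := hq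
      obtain ⟨_, -, h⟩ := hq'
      simp only [List.cons.injEq] at h
      rw [h.1, ha] at hb
      exact absurd hb (by simp)

theorem uniformOfFinset_product {γ δ : Type*} {s : Finset γ} {t : Finset δ}
    (hs : s.Nonempty) (ht : t.Nonempty) :
    PMF.uniformOfFinset (s ×ˢ t) (hs.product ht) =
      (PMF.uniformOfFinset s hs).bind fun y => (PMF.uniformOfFinset t ht).map fun z => (y, z) := by
  classical
  ext ⟨y, z⟩
  rw [PMF.bind_apply, tsum_eq_single y, PMF.map_apply, tsum_eq_single z]
  · simp only [PMF.uniformOfFinset_apply, Finset.mem_product, Finset.card_product, if_true]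
    by_cases hy : y ∈ s <;> by_cases hz : z ∈ t <;> simp [hy, hz]
    rw [ENNReal.mul_inv (Or.inr (by simp)) (Or.inl (by simp))]
  · intro z' hz'
    rw [if_neg]
    intro h
    exact hz' (Prod.ext_iff.1 h).2.symm
  · intro y' hy'
    rw [PMF.map_apply]
    convert mul_zero _
    rw [ENNReal.tsum_eq_zero]
    intro z'
    rw [if_neg]
    intro h
    exact hy' (Prod.ext_iff.1 h).1.symm

/-- If the elements of a list are put into a uniformly random order and then distributed onto two
lists, then these are independent and again in uniformly random order. -/
theorem orderings_map_filter (l : List α) (P : α → Bool) :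
    (orderings l).map (fun q => (q.filter P, q.filter fun x => !P x)) =
      (orderings (l.filter P)).bind fun y =>
        (orderings (l.filter fun x => !P x)).map fun z => (y, z) := by
  unfold orderings
  rw [← uniformOfFinset_product]
  refine map_uniformOfFinset _ _ _ (l.length.choose (l.filter P).length) ?_ ?_
  · intro q hq
    simp only [List.mem_toFinset, List.mem_permutations, Finset.mem_product] at hq ⊢
    exact ⟨hq.filter _, hq.filter _⟩
  · rintro ⟨y, z⟩ h
    simp only [List.mem_toFinset, List.mem_permutations, Finset.mem_product] at h
    have hy : ∀ x ∈ y, P x = true := fun x hx => (List.mem_filter.1 (h.1.mem_iff.1 hx)).2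
    have hz : ∀ x ∈ z, P x = false := fun x hx => by
      simpa using (List.mem_filter.1 (h.2.mem_iff.1 hx)).2
    have hlen : (l.filter P).length + (l.filter fun x => !P x).length = l.length := by
      rw [← List.length_append]
      exact (List.filter_append_perm P l).length_eq
    have key : (l.permutations.toFinset.filter fun q =>
        (q.filter P, q.filter fun x => !P x) = (y, z)) = shuffles y z := by
      ext q
      rw [mem_shuffles P y z hy hz, Finset.mem_filter, Prod.mk.injEq]
      refine ⟨fun hq => hq.2, fun hq => ⟨?_, hq⟩⟩
      rw [List.mem_toFinset, List.mem_permutations]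
      refine (List.filter_append_perm P q).symm.trans
        (List.Perm.trans ?_ (List.filter_append_perm P l))
      rw [hq.1, hq.2]
      exact h.1.append h.2
    rw [key, card_shuffles P y z hy hz, h.1.length_eq, h.2.length_eq, hlen]

end

/-! ### The error pattern and the random partition -/

noncomputable section

variable {α β : Type*} [LinearOrder α] [LinearOrder β]

theorem errorCoin_true (p : unitInterval) : errorCoin p true = ENNReal.ofReal p := by
  rw [errorCoin, Measure.toPMF_apply,
    bernoulliMeasure_apply_of_mem_of_notMem p (measurableSet_singleton _) (by simp) (by simp)]
  rw [ENNReal.ofReal, ENNReal.coe_inj]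
  exact (Real.toNNReal_of_nonneg p.2.1).symm

theorem errorCoin_false (p : unitInterval) : errorCoin p false = ENNReal.ofReal (1 - p) := by
  rw [errorCoin, Measure.toPMF_apply,
    bernoulliMeasure_apply_of_notMem_of_mem p (measurableSet_singleton _) (by simp) (by simp)]
  rw [ENNReal.ofReal, ENNReal.coe_inj]
  exact (Real.toNNReal_of_nonneg (unitInterval.symm p).2.1).symm

/-- Independent error coins for the elements of a list; the pattern is `false` elsewhere. -/
def errorPattern (p : unitInterval) : List α → PMF (α → Bool)
  | [] => PMF.pure fun _ => false
  | x :: l => (errorCoin p).bind fun b => (errorPattern p l).map fun e => Function.update e x b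

theorem errorPattern_perm (p : unitInterval) {l l' : List α} (h : l.Perm l') (hl : l.Nodup) :
    errorPattern p l = errorPattern p l' := by
  induction h with
  | nil => rfl
  | cons x h ih => rw [errorPattern, errorPattern, ih (List.nodup_cons.1 hl).2]
  | swap x y l =>
    have hxy : y ≠ x := by
      rintro rfl
      simp at hl
    simp only [errorPattern, PMF.map_bind, PMF.map_comp]
    rw [PMF.bind_comm]
    refine congrArg _ (funext fun b => congrArg _ (funext fun b' => ?_))
    congr 1
    funext e
    exact Function.update_comm hxy.symm _ _ _
  | trans h1 h2 ih1 ih2 => rw [ih1 hl, ih2 (h1.nodup_iff.1 hl)]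

/-- With pivot `a` and error pattern `e`, is `x` put into the left sublist? -/
def goesLeft (a : α) (e : α → Bool) (x : α) : Bool := xor (decide (x < a)) (e x)

theorem filter_goesLeft_update {l : List α} {x : α} (hx : x ∉ l) (a : α) (e : α → Bool) (b : Bool)
    (g : Bool → Bool) :
    (l.filter fun y => g (goesLeft a (Function.update e x b) y)) =
      l.filter fun y => g (goesLeft a e y) := by
  refine List.filter_congr fun y hy => ?_
  rw [goesLeft, goesLeft, Function.update_of_ne]
  rintro rfl
  exact hx hy

/-- The errors can be drawn at once and attached to the elements instead of their positions in the
list; the elements have to be distinct for this. -/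
theorem errorPartition_eq_map (p : unitInterval) (a : α) {l : List α} (hl : l.Nodup) :
    errorPartition p a l = (errorPattern p l).map fun e =>
      (l.filter (fun x => goesLeft a e x), l.filter fun x => !goesLeft a e x) := by
  induction l with
  | nil => simp [errorPartition, errorPattern, PMF.pure_map]
  | cons x l ih =>
    obtain ⟨hx, hl⟩ := List.nodup_cons.1 hl
    rw [errorPartition, errorPattern, ih hl, PMF.map_bind]
    refine congrArg _ (funext fun b => ?_)
    rw [PMF.map_comp, PMF.map_comp]
    congr 1
    funext e
    have h1 := filter_goesLeft_update hx a e b id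
    have h2 := filter_goesLeft_update hx a e b not
    simp only [id] at h1
    simp only [Function.comp, List.filter_cons, h1, h2]
    have : goesLeft a (Function.update e x b) x = xor (decide (x < a)) b := by simp [goesLeft]
    rw [this]
    cases xor (decide (x < a)) b <;> simp

theorem perm_of_mem_support_errorPartition (p : unitInterval) (a : α) (l : List α)
    (q : List α × List α) (hq : q ∈ (errorPartition p a l).support) :
    (q.1 ++ q.2).Perm l := by
  induction l generalizing q with
  | nil =>
    simp only [errorPartition, PMF.mem_support_pure_iff] at hq
    simp [hq]
  | cons x l ih =>
    simp only [errorPartition, PMF.mem_support_bind_iff, PMF.mem_support_map_iff] at hq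
    obtain ⟨err, -, q', hq', rfl⟩ := hq
    have h := ih q' hq'
    split_ifs
    · exact h.cons x
    · exact List.perm_middle.trans (h.cons x)

theorem perm_of_mem_support_quicksort (p : unitInterval) (l y : List α)
    (hy : y ∈ (quicksort p l).support) : y.Perm l := by
  induction hn : l.length using Nat.strong_induction_on generalizing l y with
  | _ n ih =>
    cases l with
    | nil =>
      rw [quicksort_nil, PMF.mem_support_pure_iff] at hy
      rw [hy]
    | cons a l =>
      simp only [quicksort_cons, PMF.mem_support_bind_iff, PMF.mem_support_map_iff] at hy
      obtain ⟨q, hq, y', hy', z', hz', rfl⟩ := hy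
      have hlen := length_of_mem_support_errorPartition p a l q hq
      simp only [List.length_cons] at hn
      have h1 := ih q.1.length (by omega) q.1 y' hy' rfl
      have h2 := ih q.2.length (by omega) q.2 z' hz' rfl
      exact List.perm_middle.trans
        (((h1.append h2).trans (perm_of_mem_support_errorPartition p a l q hq)).cons a)

theorem errorPartition_map (p : unitInterval) {f : α → β} (hf : StrictMono f) (a : α)
    (l : List α) :
    errorPartition p (f a) (l.map f) =
      (errorPartition p a l).map (Prod.map (List.map f) (List.map f)) := by
  induction l with
  | nil => simp [errorPartition, PMF.pure_map]
  | cons x l ih =>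
    rw [List.map_cons, errorPartition, errorPartition, ih, PMF.map_bind]
    refine congrArg _ (funext fun b => ?_)
    rw [PMF.map_comp, PMF.map_comp]
    congr 1
    funext q
    simp only [Function.comp, hf.lt_iff_lt]
    split_ifs <;> rfl

theorem quicksort_map (p : unitInterval) {f : α → β} (hf : StrictMono f) (l : List α) :
    quicksort p (l.map f) = (quicksort p l).map (List.map f) := by
  induction hn : l.length using Nat.strong_induction_on generalizing l with
  | _ n ih =>
    cases l with
    | nil => simp [quicksort_nil, PMF.pure_map]
    | cons a l =>
      simp only [List.length_cons] at hn
      rw [List.map_cons, quicksort_cons, quicksort_cons, errorPartition_map p hf, PMF.bind_map,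
        PMF.map_bind]
      refine bind_congr_of_mem_support _ _ _ fun q hq => ?_
      have hlen := length_of_mem_support_errorPartition p a l q hq
      simp only [Function.comp, Prod.map_fst, Prod.map_snd]
      rw [ih q.1.length (by omega) q.1 rfl, ih q.2.length (by omega) q.2 rfl, PMF.bind_map,
        PMF.map_bind]
      refine congrArg _ (funext fun y => ?_)
      simp only [Function.comp, PMF.map_comp]
      congr 1
      funext z
      simp

/-! ### Inversions -/

theorem inversions_nil : inversions ([] : List α) = 0 := by
  simp [inversions]

theorem inversions_map {f : α → β} (hf : StrictMono f) (l : List α) :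
    inversions (l.map f) = inversions l := by
  unfold inversions
  have hlen : (l.map f).length = l.length := List.length_map f
  refine Finset.card_bij (fun ij _ => (Fin.cast hlen ij.1, Fin.cast hlen ij.2)) ?_ ?_ ?_
  · rintro ⟨i, j⟩ h
    simpa [hf.lt_iff_lt] using h
  · rintro ⟨i, j⟩ _ ⟨i', j'⟩ _ h
    simpa using h
  · rintro ⟨i, j⟩ h
    exact ⟨(Fin.cast hlen.symm i, Fin.cast hlen.symm j), by simpa [hf.lt_iff_lt] using h, rfl⟩

theorem inversions_le (l : List α) : inversions l ≤ l.length ^ 2 := by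
  unfold inversions
  refine (Finset.card_filter_le _ _).trans ?_
  simp [sq]

theorem sum_get_eq_countP {γ : Type*} (P : γ → Bool) (l : List γ) :
    (∑ j : Fin l.length, if P (l.get j) = true then 1 else 0) = l.countP P := by
  induction l with
  | nil => simp
  | cons x l ih =>
    rw [List.countP_cons, ← ih, add_comm]
    exact Fin.sum_univ_succ (n := l.length) _

theorem inversions_cons (x : α) (l : List α) :
    inversions (x :: l) = l.countP (fun y => y < x) + inversions l := by
  have h (m : List α) : inversions m = ∑ i : Fin m.length, ∑ j : Fin m.length,
      if i < j ∧ m.get j < m.get i then 1 else 0 := by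
    rw [inversions, Finset.card_filter, Fintype.sum_prod_type]
  rw [h, h, ← sum_get_eq_countP]
  refine (Fin.sum_univ_succ (n := l.length) _).trans (congrArg₂ _ ?_ ?_)
  · refine (Fin.sum_univ_succ (n := l.length) _).trans ?_
    simp
  · refine Finset.sum_congr rfl fun i _ => ?_
    refine (Fin.sum_univ_succ (n := l.length) _).trans ?_
    simp

/-- The number of inversions between two lists. -/
def crossInversions (y z : List α) : ℕ := (y.map fun x => z.countP fun w => w < x).sum

theorem inversions_append (y z : List α) :
    inversions (y ++ z) = inversions y + inversions z + crossInversions y z := by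
  induction y with
  | nil => simp [inversions_nil, crossInversions]
  | cons x y ih =>
    simp only [List.cons_append, inversions_cons, ih, List.countP_append, crossInversions,
      List.map_cons, List.sum_cons]
    omega

theorem crossInversions_perm {y y' z z' : List α} (hy : y.Perm y') (hz : z.Perm z') :
    crossInversions y z = crossInversions y' z' := by
  unfold crossInversions
  rw [(hy.map _).sum_eq]
  simp only [hz.countP_eq]

theorem crossInversions_cons_left (a : α) (y z : List α) :
    crossInversions (a :: y) z = z.countP (fun w => w < a) + crossInversions y z := by
  simp [crossInversions]

theorem crossInversions_cons_right (y : List α) (a : α) (z : List α) :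
    crossInversions y (a :: z) = y.countP (fun x => a < x) + crossInversions y z := by
  induction y with
  | nil => simp [crossInversions]
  | cons x y ih =>
    simp only [crossInversions, List.map_cons, List.sum_cons, List.countP_cons] at ih ⊢
    rw [ih]
    omega

end

/-! ### The recursion for the number of inversions -/

noncomputable section

variable {α β : Type*} [LinearOrder α] [LinearOrder β]

/-- The law of the number of inversions when Quicksort with errors is run on a uniformly random
rearrangement of the list `l`. -/
def shuffledInversionsLaw (p : unitInterval) (l : List α) : PMF ℕ :=
  (orderings l).bind fun m => (quicksort p m).map inversions

theorem shuffledInversionsLaw_map (p : unitInterval) {f : α → β} (hf : StrictMono f)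
    (l : List α) : shuffledInversionsLaw p (l.map f) = shuffledInversionsLaw p l := by
  rw [shuffledInversionsLaw, orderings_map f hf.injective, PMF.bind_map]
  refine congrArg _ (funext fun m => ?_)
  simp only [Function.comp, quicksort_map p hf, PMF.map_comp]
  congr 1
  funext y
  exact inversions_map hf y

theorem shuffledInversionsLaw_finRange (p : unitInterval) (n : ℕ) :
    shuffledInversionsLaw p (List.finRange n) = inversionsLaw n p := by
  rw [shuffledInversionsLaw, ← map_ofFn_uniformOfFintype, PMF.bind_map]
  rfl

/-- Only the relative order of the elements matters, so the law depends only on their number. -/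
theorem shuffledInversionsLaw_eq (p : unitInterval) {l : List α} (hl : l.SortedLT) :
    shuffledInversionsLaw p l = inversionsLaw l.length p := by
  rw [← shuffledInversionsLaw_finRange,
    ← shuffledInversionsLaw_map p (f := l.get) hl.strictMono_get, ← List.ofFn_eq_map, List.ofFn_get]

/-- The inversions that the partition at the pivot `a` of a list with rest `l` creates if the errors
are given by `e`: those with the pivot, and those between the two sublists. -/
def tollCount (a : α) (e : α → Bool) (l : List α) : ℕ :=
  (l.filter fun x => goesLeft a e x).countP (fun x => a < x) +
    (l.filter fun x => !goesLeft a e x).countP (fun x => x < a) +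
    crossInversions (l.filter fun x => goesLeft a e x) (l.filter fun x => !goesLeft a e x)

theorem inversions_append_cons (a : α) (y z : List α) :
    inversions (y ++ a :: z) = inversions y + inversions z +
      (y.countP (fun x => a < x) + z.countP (fun x => x < a) + crossInversions y z) := by
  rw [inversions_append, inversions_cons, crossInversions_cons_right]
  omega

/-- `List.finRange (n + 1)` without the element `s`. -/
abbrev others {n : ℕ} (s : Fin (n + 1)) : List (Fin (n + 1)) := (List.finRange (n + 1)).erase s

theorem sortedLT_of_sublist {l l' : List α} (h : l'.Sublist l) (hl : l.SortedLT) :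
    l'.SortedLT :=
  (hl.pairwise.sublist h).sortedLT

theorem sortedLT_others {n : ℕ} (s : Fin (n + 1)) : (others s).SortedLT :=
  sortedLT_of_sublist List.erase_sublist (List.sortedLT_finRange _)

/-- The recursion for the number of inversions: pivot `s`, errors `e`, and independent copies for
the two sublists. -/
theorem inversionsLaw_succ (n : ℕ) (p : unitInterval) :
    inversionsLaw (n + 1) p = (PMF.uniformOfFintype (Fin (n + 1))).bind fun s =>
      (errorPattern p (others s)).bind fun e =>
        (inversionsLaw ((others s).filter fun x => goesLeft s e x).length p).bind fun i =>
          (inversionsLaw ((others s).filter fun x => !goesLeft s e x).length p).map fun j =>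
            i + j + tollCount s e (others s) := by
  rw [← shuffledInversionsLaw_finRange, shuffledInversionsLaw, orderings_finRange_succ,
    PMF.bind_bind]
  refine congrArg _ (funext fun s => ?_)
  set l := others s with hl
  have hsort : l.SortedLT := sortedLT_others s
  have hnd : l.Nodup := hsort.nodup
  rw [PMF.bind_map]
  -- run the partition on a random ordering
  have h1 : (orderings l).bind ((fun m => (quicksort p m).map inversions) ∘ List.cons s) =
      (orderings l).bind fun m => (errorPattern p l).bind fun e =>
        (quicksort p (m.filter fun x => goesLeft s e x)).bind fun y =>
          (quicksort p (m.filter fun x => !goesLeft s e x)).map fun z =>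
            inversions (y ++ s :: z) := by
    refine bind_congr_of_mem_support _ _ _ fun m hm => ?_
    rw [mem_support_orderings] at hm
    simp only [Function.comp, quicksort_cons]
    rw [errorPartition_eq_map p s (hm.nodup_iff.2 hnd),
      errorPattern_perm p hm (hm.nodup_iff.2 hnd), PMF.bind_map, PMF.map_bind]
    refine congrArg _ (funext fun e => ?_)
    simp only [Function.comp, PMF.map_bind, PMF.map_comp]
    rfl
  rw [h1, PMF.bind_comm]
  refine congrArg _ (funext fun e => ?_)
  -- the two sublists are independent random orderings
  have h2 : ((orderings l).bind fun m =>
        (quicksort p (m.filter fun x => goesLeft s e x)).bind fun y =>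
          (quicksort p (m.filter fun x => !goesLeft s e x)).map fun z =>
            inversions (y ++ s :: z)) =
      ((orderings l).map fun q => (q.filter fun x => goesLeft s e x,
        q.filter fun x => !goesLeft s e x)).bind fun q =>
          (quicksort p q.1).bind fun y => (quicksort p q.2).map fun z =>
            inversions (y ++ s :: z) := by
    rw [PMF.bind_map]
    rfl
  rw [h2, orderings_map_filter, PMF.bind_bind]
  simp only [PMF.bind_map]
  rw [← shuffledInversionsLaw_eq p (l := l.filter fun x => goesLeft s e x)
      (sortedLT_of_sublist List.filter_sublist hsort),
    ← shuffledInversionsLaw_eq p (l := l.filter fun x => !goesLeft s e x)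
      (sortedLT_of_sublist List.filter_sublist hsort),
    shuffledInversionsLaw, shuffledInversionsLaw, PMF.bind_bind]
  refine bind_congr_of_mem_support _ _ _ fun y hy => ?_
  rw [mem_support_orderings] at hy
  simp only [PMF.bind_map, PMF.map_bind, PMF.map_comp, Function.comp_def]
  rw [PMF.bind_comm]
  refine bind_congr_of_mem_support _ _ _ fun y' hy' => ?_
  refine bind_congr_of_mem_support _ _ _ fun z hz => ?_
  rw [mem_support_orderings] at hz
  rw [← PMF.bind_pure_comp, ← PMF.bind_pure_comp]
  refine bind_congr_of_mem_support _ _ _ fun z' hz' => ?_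
  have hy2 := (perm_of_mem_support_quicksort p _ _ hy').trans hy
  have hz2 := (perm_of_mem_support_quicksort p _ _ hz').trans hz
  refine congrArg PMF.pure ?_
  beta_reduce
  rw [inversions_append_cons, tollCount, hy2.countP_eq, hz2.countP_eq, crossInversions_perm hy2 hz2]

end

/-! ### Moments of the size of the left sublist and of the number of cross inversions -/

noncomputable section

variable {α β : Type*} [LinearOrder α] [LinearOrder β]

theorem tsum_bind_mul {γ δ : Type*} (P : PMF γ) (f : γ → PMF δ) (F : δ → ENNReal) :
    ∑' e, P.bind f e * F e = ∑' a, P a * ∑' e, f a e * F e := by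
  simp only [PMF.bind_apply, ← ENNReal.tsum_mul_right, ← ENNReal.tsum_mul_left]
  rw [ENNReal.tsum_comm]
  simp only [mul_assoc]

theorem tsum_map_mul {γ δ : Type*} (P : PMF γ) (f : γ → δ) (F : δ → ENNReal) :
    ∑' e, P.map f e * F e = ∑' a, P a * F (f a) := by
  rw [← PMF.bind_pure_comp, tsum_bind_mul]
  refine tsum_congr fun a => ?_
  rw [tsum_eq_single (f a)]
  · simp
  · intro b hb
    simp [hb]

/-- The expectation of `G (Z, C)` for the Markov chain which starts at `(0, 0)` and in the step with
parameter `q` moves from `(z, c)` to `(z + 1, c)` with probability `q` and to `(z, c + z)` with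
probability `1 - q`; the last element of the list belongs to the first step. -/
def chainMean : List ℝ → (ℝ → ℝ → ℝ) → ℝ
  | [], G => G 0 0
  | q :: l, G => q * chainMean l (fun z c => G (z + 1) c) +
      (1 - q) * chainMean l (fun z c => G z (c + z))

theorem chainMean_add (l : List ℝ) (G H : ℝ → ℝ → ℝ) :
    chainMean l (fun z c => G z c + H z c) = chainMean l G + chainMean l H := by
  induction l generalizing G H with
  | nil => rfl
  | cons q l ih => simp only [chainMean, ih]; ring

theorem chainMean_mul (l : List ℝ) (a : ℝ) (G : ℝ → ℝ → ℝ) :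
    chainMean l (fun z c => a * G z c) = a * chainMean l G := by
  induction l generalizing G with
  | nil => rfl
  | cons q l ih => simp only [chainMean, ih]; ring

theorem chainMean_const (l : List ℝ) (a : ℝ) : chainMean l (fun _ _ => a) = a := by
  induction l with
  | nil => rfl
  | cons q l ih => simp only [chainMean, ih]; ring

theorem chainMean_mono {l : List ℝ} (hl : ∀ q ∈ l, 0 ≤ q ∧ q ≤ 1) {G H : ℝ → ℝ → ℝ}
    (h : ∀ z c, G z c ≤ H z c) : chainMean l G ≤ chainMean l H := by
  induction l generalizing G H with
  | nil => exact h 0 0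
  | cons q l ih =>
    have hq := hl q (by simp)
    have hl' : ∀ q ∈ l, 0 ≤ q ∧ q ≤ 1 := fun q hq => hl q (by simp [hq])
    exact add_le_add
      (mul_le_mul_of_nonneg_left (ih hl' fun z c => h _ _) hq.1)
      (mul_le_mul_of_nonneg_left (ih hl' fun z c => h _ _) (by linarith))

/-- The mean of `C` in the chain of `chainMean`; the mean of `Z` is the sum of the list. -/
def crossMean : List ℝ → ℝ
  | [] => 0
  | q :: l => crossMean l + (1 - q) * l.sum

theorem sum_nonneg_le {l : List ℝ} (hl : ∀ q ∈ l, 0 ≤ q ∧ q ≤ 1) :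
    0 ≤ l.sum ∧ l.sum ≤ l.length := by
  induction l with
  | nil => simp
  | cons q l ih =>
    have hq := hl q (by simp)
    have := ih fun q hq => hl q (by simp [hq])
    simp only [List.sum_cons, List.length_cons, Nat.cast_add, Nat.cast_one]
    constructor <;> linarith

theorem chainMean_fst_sub (l : List ℝ) : chainMean l (fun z _ => z - l.sum) = 0 := by
  induction l with
  | nil => simp [chainMean]
  | cons q l ih =>
    have h1 : (fun z _ : ℝ => z + 1 - (q :: l).sum) = fun z _ => (z - l.sum) + (1 - q) := by
      funext z c; simp; ring
    have h2 : (fun z _ : ℝ => z - (q :: l).sum) = fun z _ => (z - l.sum) + (- q) := by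
      funext z c; simp; ring
    rw [chainMean, h1, h2, chainMean_add l (fun z _ => z - l.sum) (fun _ _ => 1 - q),
      chainMean_add l (fun z _ => z - l.sum) (fun _ _ => -q), chainMean_const, chainMean_const, ih]
    ring

theorem chainMean_snd_sub (l : List ℝ) : chainMean l (fun _ c => c - crossMean l) = 0 := by
  induction l with
  | nil => simp [chainMean, crossMean]
  | cons q l ih =>
    have h1 : (fun _ c : ℝ => c - crossMean (q :: l)) =
        fun _ c => (c - crossMean l) + (-((1 - q) * l.sum)) := by
      funext z c; simp [crossMean]; ring
    have h2 : (fun z c : ℝ => c + z - crossMean (q :: l)) =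
        fun z c => (c - crossMean l) + ((z - l.sum) + q * l.sum) := by
      funext z c; simp [crossMean]; ring
    rw [chainMean, h1, h2,
      chainMean_add l (fun _ c => c - crossMean l) (fun _ _ => -((1 - q) * l.sum)),
      chainMean_add l (fun _ c => c - crossMean l) (fun z _ => (z - l.sum) + q * l.sum),
      chainMean_add l (fun z _ => z - l.sum) (fun _ _ => q * l.sum),
      chainMean_const, chainMean_const, ih, chainMean_fst_sub]
    ring

/-- The variance of `Z` is at most the number of steps. -/
theorem chainMean_fst_sq_le {l : List ℝ} (hl : ∀ q ∈ l, 0 ≤ q ∧ q ≤ 1) :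
    chainMean l (fun z _ => (z - l.sum) ^ 2) ≤ l.length := by
  induction l with
  | nil => simp [chainMean]
  | cons q l ih =>
    have hq := hl q (by simp)
    have ih := ih fun q hq => hl q (by simp [hq])
    have h1 : (fun z _ : ℝ => (z + 1 - (q :: l).sum) ^ 2) =
        fun z _ => (z - l.sum) ^ 2 + (2 * (1 - q) * (z - l.sum) + (1 - q) ^ 2) := by
      funext z c; simp; ring
    have h2 : (fun z _ : ℝ => (z - (q :: l).sum) ^ 2) =
        fun z _ => (z - l.sum) ^ 2 + ((- 2 * q) * (z - l.sum) + q ^ 2) := by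
      funext z c; simp; ring
    rw [chainMean, h1, h2]
    simp only [chainMean_add l, chainMean_mul l, chainMean_const, chainMean_fst_sub]
    push_cast [List.length_cons]
    nlinarith [mul_nonneg hq.1 (sub_nonneg.2 hq.2)]

theorem chainMean_fst_sq_nonneg {l : List ℝ} (hl : ∀ q ∈ l, 0 ≤ q ∧ q ≤ 1) :
    0 ≤ chainMean l (fun z _ => (z - l.sum) ^ 2) := by
  rw [← chainMean_const l 0]
  exact chainMean_mono hl fun z c => sq_nonneg _

/-- A bound for the covariance of `Z` and `C`. -/
theorem abs_chainMean_mul_le {l : List ℝ} (hl : ∀ q ∈ l, 0 ≤ q ∧ q ≤ 1) :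
    |chainMean l (fun z c => (z - l.sum) * (c - crossMean l))| ≤ (l.length : ℝ) ^ 2 := by
  induction l with
  | nil => simp [chainMean]
  | cons q l ih =>
    have hq := hl q (by simp)
    have hl' : ∀ q ∈ l, 0 ≤ q ∧ q ≤ 1 := fun q hq => hl q (by simp [hq])
    have ih := ih hl'
    have hV := chainMean_fst_sq_le hl'
    have hV0 := chainMean_fst_sq_nonneg hl'
    have hS := sum_nonneg_le hl'
    set V := chainMean l (fun z _ => (z - l.sum) ^ 2) with hVdef
    have h1 : (fun z c : ℝ => (z + 1 - (q :: l).sum) * (c - crossMean (q :: l))) =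
        fun z c => (z - l.sum) * (c - crossMean l) + ((1 - q) * (c - crossMean l) +
          (-((1 - q) * l.sum) * (z - l.sum) + (-((1 - q) ^ 2 * l.sum)))) := by
      funext z c; simp [crossMean]; ring
    have h2 : (fun z c : ℝ => (z - (q :: l).sum) * (c + z - crossMean (q :: l))) =
        fun z c => (z - l.sum) * (c - crossMean l) + ((z - l.sum) ^ 2 + ((- q) * (c - crossMean l) +
          ((q * l.sum - q) * (z - l.sum) + (- (q ^ 2 * l.sum))))) := by
      funext z c; simp [crossMean]; ring
    have key : chainMean (q :: l) (fun z c => (z - (q :: l).sum) * (c - crossMean (q :: l))) =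
        chainMean l (fun z c => (z - l.sum) * (c - crossMean l)) +
          ((1 - q) * V - q * (1 - q) * l.sum) := by
      rw [chainMean, h1, h2]
      simp only [chainMean_add l, chainMean_mul l, chainMean_const, chainMean_fst_sub,
        chainMean_snd_sub, ← hVdef]
      ring
    rw [key]
    push_cast [List.length_cons]
    have hk : (0 : ℝ) ≤ l.length := Nat.cast_nonneg _
    have h3 : |(1 - q) * V - q * (1 - q) * l.sum| ≤ l.length := by
      rw [abs_le]
      constructor <;>
        nlinarith [mul_nonneg hq.1 (sub_nonneg.2 hq.2), mul_nonneg (sub_nonneg.2 hq.2) hV0,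
        mul_nonneg (mul_nonneg hq.1 (sub_nonneg.2 hq.2)) hS.1, mul_nonneg hq.1 hV0,
        mul_le_mul_of_nonneg_left hS.2 (mul_nonneg hq.1 (sub_nonneg.2 hq.2)), mul_nonneg hq.1 hq.1]
    refine (abs_add_le _ _).trans ?_
    nlinarith

/-- The variance of `C` is at most the third power of the number of steps. -/
theorem chainMean_snd_sq_le {l : List ℝ} (hl : ∀ q ∈ l, 0 ≤ q ∧ q ≤ 1) :
    chainMean l (fun _ c => (c - crossMean l) ^ 2) ≤ (l.length : ℝ) ^ 3 := by
  induction l with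
  | nil => simp [chainMean, crossMean]
  | cons q l ih =>
    have hq := hl q (by simp)
    have hl' : ∀ q ∈ l, 0 ≤ q ∧ q ≤ 1 := fun q hq => hl q (by simp [hq])
    have ih := ih hl'
    have hV := chainMean_fst_sq_le hl'
    have hV0 := chainMean_fst_sq_nonneg hl'
    have hS := sum_nonneg_le hl'
    have hC := abs_chainMean_mul_le hl'
    set V := chainMean l (fun z _ => (z - l.sum) ^ 2) with hVdef
    set K := chainMean l (fun z c => (z - l.sum) * (c - crossMean l)) with hKdef
    have h1 : (fun _ c : ℝ => (c - crossMean (q :: l)) ^ 2) =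
        fun z c => (c - crossMean l) ^ 2 + ((-(2 * (1 - q) * l.sum)) * (c - crossMean l) +
          ((1 - q) * l.sum) ^ 2) := by
      funext z c; simp [crossMean]; ring
    have h2 : (fun z c : ℝ => (c + z - crossMean (q :: l)) ^ 2) =
        fun z c => (c - crossMean l) ^ 2 + (2 * ((z - l.sum) * (c - crossMean l)) +
          ((2 * q * l.sum) * (c - crossMean l) + ((z - l.sum) ^ 2 +
            ((2 * q * l.sum) * (z - l.sum) + (q * l.sum) ^ 2)))) := by
      funext z c; simp [crossMean]; ring
    have key : chainMean (q :: l) (fun _ c => (c - crossMean (q :: l)) ^ 2) =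
        chainMean l (fun _ c => (c - crossMean l) ^ 2) + (1 - q) * (2 * K + V) +
          q * (1 - q) * l.sum ^ 2 := by
      rw [chainMean, h1, h2]
      simp only [chainMean_add l, chainMean_mul l, chainMean_const, chainMean_fst_sub,
        chainMean_snd_sub, ← hVdef, ← hKdef]
      ring
    rw [key]
    push_cast [List.length_cons]
    have hk : (0 : ℝ) ≤ l.length := Nat.cast_nonneg _
    have h3 : l.sum ^ 2 ≤ (l.length : ℝ) ^ 2 := pow_le_pow_left₀ hS.1 hS.2 2
    have h4 : (1 - q) * (2 * K + V) ≤ 2 * (l.length : ℝ) ^ 2 + l.length := by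
      have : (1 - q) * (2 * K + V) ≤ (1 - q) * (2 * (l.length : ℝ) ^ 2 + l.length) :=
        mul_le_mul_of_nonneg_left (by linarith [(abs_le.1 hC).2]) (by linarith)
      nlinarith [mul_nonneg hq.1 (by positivity : 0 ≤ 2 * (l.length : ℝ) ^ 2 + l.length)]
    have h5 : q * (1 - q) * l.sum ^ 2 ≤ (l.length : ℝ) ^ 2 := by
      have : q * (1 - q) ≤ 1 := by nlinarith
      nlinarith [sq_nonneg l.sum, mul_nonneg hq.1 (sub_nonneg.2 hq.2)]
    nlinarith

/-- The first absolute moment is at most the root of the second moment. -/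
theorem chainMean_abs_le {l : List ℝ} (hl : ∀ q ∈ l, 0 ≤ q ∧ q ≤ 1) (G : ℝ → ℝ → ℝ) {h : ℝ}
    (hh : 0 ≤ h) (hG : chainMean l (fun z c => G z c ^ 2) ≤ h ^ 2) :
    chainMean l (fun z c => |G z c|) ≤ h := by
  have key : ∀ ε > 0, chainMean l (fun z c => |G z c|) ≤ h + ε := by
    intro ε hε
    have hpos : 0 < h + ε := by linarith
    -- the arithmetic-geometric mean inequality, with weights that are optimal at `|G| = h + ε`
    have h1 : ∀ z c, |G z c| ≤ (2 * (h + ε))⁻¹ * G z c ^ 2 + (h + ε) / 2 := by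
      intro z c
      rw [← sq_abs (G z c)]
      have : (2 * (h + ε))⁻¹ * |G z c| ^ 2 + (h + ε) / 2 - |G z c| =
          (2 * (h + ε))⁻¹ * (|G z c| - (h + ε)) ^ 2 := by
        field_simp
        ring
      nlinarith [show 0 ≤ (2 * (h + ε))⁻¹ * (|G z c| - (h + ε)) ^ 2 by positivity]
    refine (chainMean_mono hl h1).trans ?_
    rw [chainMean_add l (fun z c => (2 * (h + ε))⁻¹ * G z c ^ 2) (fun _ _ => (h + ε) / 2),
      chainMean_mul, chainMean_const]
    have h2 : (2 * (h + ε))⁻¹ * chainMean l (fun z c => G z c ^ 2) ≤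
        (2 * (h + ε))⁻¹ * (h + ε) ^ 2 :=
      mul_le_mul_of_nonneg_left (hG.trans (pow_le_pow_left₀ hh (by linarith) 2)) (by positivity)
    have h3 : (2 * (h + ε))⁻¹ * (h + ε) ^ 2 = (h + ε) / 2 := by field_simp
    linarith
  exact le_of_forall_pos_le_add key

/-- The probability that an element is put to the left of the pivot `a`. -/
def leftProb (p : unitInterval) (a x : α) : ℝ := if x < a then 1 - p else p

theorem leftProb_mem (p : unitInterval) (a x : α) : 0 ≤ leftProb p a x ∧ leftProb p a x ≤ 1 := by
  have h0 := p.2.1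
  have h1 := p.2.2
  unfold leftProb
  split_ifs
  · constructor <;> linarith
  · exact ⟨h0, h1⟩

/-- If the elements are read in decreasing order, then the size of the left sublist and the number
of inversions between the two sublists form the Markov chain of `chainMean`. -/
theorem tsum_errorPattern_mul (p : unitInterval) (a : α) {l : List α} (hl : l.SortedLT)
    (G : ℝ → ℝ → ℝ) (hG : ∀ z c, 0 ≤ G z c) :
    ∑' e, errorPattern p l e * ENNReal.ofReal (G (l.filter fun x => goesLeft a e x).length
        (crossInversions (l.filter fun x => goesLeft a e x) (l.filter fun x => !goesLeft a e x))) =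
      ENNReal.ofReal (chainMean (l.map (leftProb p a)) G) := by
  induction l generalizing G with
  | nil =>
    simp only [errorPattern, chainMean, List.map_nil, List.filter_nil]
    rw [tsum_eq_single fun _ => false]
    · simp [crossInversions]
    · intro e he
      simp [he]
  | cons x l ih =>
    have hnd := hl.nodup
    have hx := (List.nodup_cons.1 hnd).1
    have hlt : ∀ y ∈ l, x < y := (List.pairwise_cons.1 hl.pairwise).1
    have ih := ih (sortedLT_of_sublist (List.sublist_cons_self x l) hl)
    have hR (e : α → Bool) : (l.filter fun y => !goesLeft a e y).countP (fun y => y < x) = 0 := by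
      rw [List.countP_eq_zero]
      intro y hy
      simpa using (hlt y (List.mem_filter.1 hy).1).le
    have hL (e : α → Bool) : (l.filter fun y => goesLeft a e y).countP (fun y => x < y) =
        (l.filter fun y => goesLeft a e y).length := by
      rw [List.countP_eq_length]
      intro y hy
      simpa using hlt y (List.mem_filter.1 hy).1
    have hstep (b : Bool) : ∑' e, ((errorPattern p l).map fun e => Function.update e x b) e *
        ENNReal.ofReal (G ((x :: l).filter fun y => goesLeft a e y).length
        (crossInversions ((x :: l).filter fun y => goesLeft a e y)
          ((x :: l).filter fun y => !goesLeft a e y))) =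
        if xor (decide (x < a)) b then
          ENNReal.ofReal (chainMean (l.map (leftProb p a)) fun z c => G (z + 1) c)
        else ENNReal.ofReal (chainMean (l.map (leftProb p a)) fun z c => G z (c + z)) := by
      rw [tsum_map_mul]
      have hb (e : α → Bool) : goesLeft a (Function.update e x b) x = xor (decide (x < a)) b := by
        simp [goesLeft]
      have h1 (e : α → Bool) := filter_goesLeft_update hx a e b id
      have h2 (e : α → Bool) := filter_goesLeft_update hx a e b not
      simp only [id] at h1
      simp only [List.filter_cons, hb, h1, h2]
      cases xor (decide (x < a)) b
      · simp only [Bool.not_false, if_true, Bool.false_eq_true, if_false]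
        rw [← ih _ fun z c => hG _ _]
        refine tsum_congr fun e => ?_
        rw [crossInversions_cons_right, hL]
        push_cast
        rw [add_comm (List.length _ : ℝ)]
      · simp only [Bool.not_true, if_true, Bool.false_eq_true, if_false]
        rw [← ih _ fun z c => hG _ _]
        refine tsum_congr fun e => ?_
        rw [crossInversions_cons_left, hR, zero_add, List.length_cons, Nat.cast_add_one]
    have hq : ∀ q ∈ l.map (leftProb p a), 0 ≤ q ∧ q ≤ 1 := by
      intro q hq
      obtain ⟨y, -, rfl⟩ := List.mem_map.1 hq
      exact leftProb_mem p a y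
    have hnn (H : ℝ → ℝ → ℝ) (hH : ∀ z c, 0 ≤ H z c) :
        0 ≤ chainMean (l.map (leftProb p a)) H := by
      rw [← chainMean_const (l.map (leftProb p a)) 0]
      exact chainMean_mono hq hH
    have n1 := hnn (fun z c => G (z + 1) c) fun _ _ => hG _ _
    have n2 := hnn (fun z c => G z (c + z)) fun _ _ => hG _ _
    have hp0 := p.2.1
    have hp1 : 0 ≤ 1 - (p : ℝ) := sub_nonneg.2 p.2.2
    rw [errorPattern, tsum_bind_mul, tsum_bool, hstep, hstep, errorCoin_true, errorCoin_false,
      List.map_cons, chainMean]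
    by_cases hxa : x < a
    · simp only [hxa, decide_true, Bool.xor_false, if_true, Bool.xor_true, Bool.not_true,
        Bool.false_eq_true, if_false, leftProb]
      rw [← ENNReal.ofReal_mul hp0, ← ENNReal.ofReal_mul hp1, ← ENNReal.ofReal_add
        (mul_nonneg hp1 n1) (mul_nonneg hp0 n2)]
      congr 1
      unfold leftProb
      ring
    · simp only [hxa, decide_false, Bool.xor_false, if_true, Bool.xor_true, Bool.not_false,
        Bool.false_eq_true, if_false, leftProb]
      rw [← ENNReal.ofReal_mul hp0, ← ENNReal.ofReal_mul hp1, ← ENNReal.ofReal_add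
        (mul_nonneg hp1 n2) (mul_nonneg hp0 n1)]
      congr 1
      unfold leftProb
      ring

end

/-! ### Couplings of laws on the real line -/

noncomputable section

/-- There is a coupling `(X, Y)` of `μ` and `ν` with `E |X - Y| ≤ r`. -/
def CoupledWithin (μ ν : Measure ℝ) (r : ℝ) : Prop :=
  ∃ π : Measure (ℝ × ℝ), π.map Prod.fst = μ ∧ π.map Prod.snd = ν ∧
    ∫⁻ z, ENNReal.ofReal |z.1 - z.2| ∂π ≤ ENNReal.ofReal r

theorem CoupledWithin.mono {μ ν : Measure ℝ} {r r' : ℝ} (h : CoupledWithin μ ν r) (hr : r ≤ r') :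
    CoupledWithin μ ν r' := by
  obtain ⟨π, h1, h2, h3⟩ := h
  exact ⟨π, h1, h2, h3.trans (ENNReal.ofReal_le_ofReal hr)⟩

theorem CoupledWithin.wassersteinDist_le {μ ν : Measure ℝ} {r : ℝ} (h : CoupledWithin μ ν r) :
    wassersteinDist μ ν ≤ ENNReal.ofReal r := by
  obtain ⟨π, h1, h2, h3⟩ := h
  exact (iInf_le _ ⟨π, h1, h2⟩).trans h3

theorem isProbabilityMeasure_of_map {γ δ : Type*} [MeasurableSpace γ] [MeasurableSpace δ]
    {π : Measure γ} {μ : Measure δ} [IsProbabilityMeasure μ] {f : γ → δ} (hf : Measurable f)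
    (h : π.map f = μ) : IsProbabilityMeasure π :=
  ⟨by rw [← Set.preimage_univ (f := f), ← Measure.map_apply hf MeasurableSet.univ, h, measure_univ]⟩

theorem lintegral_ofReal_abs {μ : Measure ℝ} (hμ : Integrable (fun x : ℝ => x) μ) :
    ∫⁻ x, ENNReal.ofReal |x| ∂μ = ENNReal.ofReal (∫ x, |x| ∂μ) :=
  (ofReal_integral_eq_lintegral_ofReal hμ.abs (ae_of_all _ fun _ => abs_nonneg _)).symm

/-- The independent coupling. -/
theorem coupledWithin_of_integrable {μ ν : Measure ℝ} [IsProbabilityMeasure μ]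
    [IsProbabilityMeasure ν] (hμ : Integrable (fun x : ℝ => x) μ)
    (hν : Integrable (fun x : ℝ => x) ν) :
    CoupledWithin μ ν (∫ x, |x| ∂μ + ∫ x, |x| ∂ν) := by
  refine ⟨μ.prod ν, by simp, by simp, ?_⟩
  have hm : Measurable fun x : ℝ => ENNReal.ofReal |x| := by fun_prop
  calc ∫⁻ z, ENNReal.ofReal |z.1 - z.2| ∂(μ.prod ν)
      ≤ ∫⁻ z, (ENNReal.ofReal |z.1| + ENNReal.ofReal |z.2|) ∂(μ.prod ν) := by
        refine lintegral_mono fun z => ?_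
        rw [← ENNReal.ofReal_add (abs_nonneg _) (abs_nonneg _)]
        exact ENNReal.ofReal_le_ofReal (abs_sub _ _)
    _ = ∫⁻ z, ENNReal.ofReal |z.1| ∂(μ.prod ν) + ∫⁻ z, ENNReal.ofReal |z.2| ∂(μ.prod ν) :=
        lintegral_add_left (hm.comp measurable_fst) _
    _ = ∫⁻ x, ENNReal.ofReal |x| ∂μ + ∫⁻ x, ENNReal.ofReal |x| ∂ν := by
        rw [← lintegral_map hm measurable_fst, ← lintegral_map hm measurable_snd]
        simp
    _ = ENNReal.ofReal (∫ x, |x| ∂μ + ∫ x, |x| ∂ν) := by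
        rw [lintegral_ofReal_abs hμ, lintegral_ofReal_abs hν, ENNReal.ofReal_add] <;>
        exact integral_nonneg fun _ => abs_nonneg _

/-- Couplings can be mixed. -/
theorem CoupledWithin.sum {ι : Type*} (w : ι → ENNReal) (μ ν : ι → Measure ℝ) (r : ι → ℝ) (R : ℝ)
    (h : ∀ i, CoupledWithin (μ i) (ν i) (r i))
    (hR : ∑' i, w i * ENNReal.ofReal (r i) ≤ ENNReal.ofReal R) :
    CoupledWithin (Measure.sum fun i => w i • μ i) (Measure.sum fun i => w i • ν i) R := by
  choose π h1 h2 h3 using h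
  refine ⟨Measure.sum fun i => w i • π i, ?_, ?_, ?_⟩
  · rw [Measure.map_sum measurable_fst.aemeasurable]
    simp only [Measure.map_smul, h1]
  · rw [Measure.map_sum measurable_snd.aemeasurable]
    simp only [Measure.map_smul, h2]
  · rw [lintegral_sum_measure]
    refine le_trans (ENNReal.tsum_le_tsum fun i => ?_) hR
    rw [lintegral_smul_measure, smul_eq_mul]
    gcongr
    exact h3 i

/-- The law of `a U * X + b U * Y + t U` for independent `X`, `Y`, `U` with laws `μ`, `ν`, `τ`. -/
def combinationLaw (μ ν τ : Measure ℝ) (a b t : ℝ → ℝ) : Measure ℝ :=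
  (μ.prod (ν.prod τ)).map fun w => a w.2.2 * w.1 + b w.2.2 * w.2.1 + t w.2.2

/-- Couplings of the independent ingredients give a coupling of the combined variables. -/
theorem coupledWithin_combinationLaw {μ ν μ' ν' τ : Measure ℝ} [IsProbabilityMeasure μ]
    [IsProbabilityMeasure ν] [IsProbabilityMeasure τ]
    [IsProbabilityMeasure μ'] [IsProbabilityMeasure ν'] {a b t a' b' t' : ℝ → ℝ}
    (ha : Measurable a) (hb : Measurable b) (ht : Measurable t) (ha' : Measurable a')
    (hb' : Measurable b') (ht' : Measurable t') (ha0 : ∀ u, 0 ≤ a u) (hb0 : ∀ u, 0 ≤ b u)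
    {r₁ r₂ : ℝ} (h₁ : CoupledWithin μ μ' r₁) (h₂ : CoupledWithin ν ν' r₂) {R : ℝ}
    (hR : ENNReal.ofReal r₁ * ∫⁻ u, ENNReal.ofReal (a u) ∂τ +
      ENNReal.ofReal r₂ * ∫⁻ u, ENNReal.ofReal (b u) ∂τ +
      (∫⁻ x, ENNReal.ofReal |x| ∂μ') * ∫⁻ u, ENNReal.ofReal |a u - a' u| ∂τ +
      (∫⁻ x, ENNReal.ofReal |x| ∂ν') * ∫⁻ u, ENNReal.ofReal |b u - b' u| ∂τ +
      ∫⁻ u, ENNReal.ofReal |t u - t' u| ∂τ ≤ ENNReal.ofReal R) :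
    CoupledWithin (combinationLaw μ ν τ a b t) (combinationLaw μ' ν' τ a' b' t') R := by
  obtain ⟨π₁, h11, h12, h13⟩ := h₁
  obtain ⟨π₂, h21, h22, h23⟩ := h₂
  have i1 := isProbabilityMeasure_of_map measurable_fst h11
  have i2 := isProbabilityMeasure_of_map measurable_fst h21
  set f : (ℝ × ℝ) × (ℝ × ℝ) × ℝ → ℝ :=
    fun w => a w.2.2 * w.1.1 + b w.2.2 * w.2.1.1 + t w.2.2 with hf
  set g : (ℝ × ℝ) × (ℝ × ℝ) × ℝ → ℝ :=
    fun w => a' w.2.2 * w.1.2 + b' w.2.2 * w.2.1.2 + t' w.2.2 with hg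
  have hfm : Measurable f := by fun_prop
  have hgm : Measurable g := by fun_prop
  refine ⟨(π₁.prod (π₂.prod τ)).map fun w => (f w, g w), ?_, ?_, ?_⟩
  · rw [Measure.map_map measurable_fst (hfm.prodMk hgm), combinationLaw, ← h11, ← h21]
    nth_rewrite 2 [← Measure.map_id (μ := τ)]
    rw [Measure.map_prod_map _ _ measurable_fst measurable_id, Measure.map_prod_map _ _
      measurable_fst (measurable_fst.prodMap measurable_id), Measure.map_map (by fun_prop)
        (measurable_fst.prodMap (measurable_fst.prodMap measurable_id))]
    rfl
  · rw [Measure.map_map measurable_snd (hfm.prodMk hgm), combinationLaw, ← h12, ← h22]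
    nth_rewrite 2 [← Measure.map_id (μ := τ)]
    rw [Measure.map_prod_map _ _ measurable_snd measurable_id, Measure.map_prod_map _ _
      measurable_snd (measurable_snd.prodMap measurable_id), Measure.map_map (by fun_prop)
        (measurable_snd.prodMap (measurable_snd.prodMap measurable_id))]
    rfl
  · rw [lintegral_map (by fun_prop) (hfm.prodMk hgm)]
    refine le_trans ?_ hR
    have hpt : ∀ w : (ℝ × ℝ) × (ℝ × ℝ) × ℝ, ENNReal.ofReal |f w - g w| ≤
        ENNReal.ofReal |w.1.1 - w.1.2| * ENNReal.ofReal (a w.2.2) +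
        ENNReal.ofReal |w.2.1.1 - w.2.1.2| * ENNReal.ofReal (b w.2.2) +
        ENNReal.ofReal |w.1.2| * ENNReal.ofReal |a w.2.2 - a' w.2.2| +
        ENNReal.ofReal |w.2.1.2| * ENNReal.ofReal |b w.2.2 - b' w.2.2| +
        ENNReal.ofReal |t w.2.2 - t' w.2.2| := by
      rintro ⟨⟨x, x'⟩, ⟨y, y'⟩, u⟩
      simp only [hf, hg]
      rw [← ENNReal.ofReal_mul (abs_nonneg _), ← ENNReal.ofReal_mul (abs_nonneg _),
        ← ENNReal.ofReal_mul (abs_nonneg _), ← ENNReal.ofReal_mul (abs_nonneg _)]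
      have p1 := mul_nonneg (abs_nonneg (x - x')) (ha0 u)
      have p2 := mul_nonneg (abs_nonneg (y - y')) (hb0 u)
      have p3 := mul_nonneg (abs_nonneg x') (abs_nonneg (a u - a' u))
      have p4 := mul_nonneg (abs_nonneg y') (abs_nonneg (b u - b' u))
      rw [← ENNReal.ofReal_add p1 p2, ← ENNReal.ofReal_add (by positivity) p3,
        ← ENNReal.ofReal_add (by positivity) p4,
        ← ENNReal.ofReal_add (by positivity) (abs_nonneg _)]
      refine ENNReal.ofReal_le_ofReal ?_
      have e : a u * x + b u * y + t u - (a' u * x' + b' u * y' + t' u) =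
          (x - x') * a u + (y - y') * b u + x' * (a u - a' u) + y' * (b u - b' u) +
            (t u - t' u) := by ring
      rw [e]
      refine (abs_add_le _ _).trans (add_le_add_left ?_ _)
      refine (abs_add_le _ _).trans (add_le_add ?_ (abs_mul _ _).le)
      refine (abs_add_le _ _).trans (add_le_add ?_ (abs_mul _ _).le)
      refine (abs_add_le _ _).trans (add_le_add ?_ ?_)
      · rw [abs_mul, abs_of_nonneg (ha0 u)]
      · rw [abs_mul, abs_of_nonneg (hb0 u)]
    refine (lintegral_mono hpt).trans ?_
    rw [lintegral_add_right _ (by fun_prop), lintegral_add_right _ (by fun_prop),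
      lintegral_add_right _ (by fun_prop), lintegral_add_right _ (by fun_prop)]
    have m1 : ∫⁻ z, ENNReal.ofReal |z.2| ∂π₁ = ∫⁻ x, ENNReal.ofReal |x| ∂μ' := by
      rw [← h12, lintegral_map (by fun_prop) measurable_snd]
    have m2 : ∫⁻ z, ENNReal.ofReal |z.2| ∂π₂ = ∫⁻ x, ENNReal.ofReal |x| ∂ν' := by
      rw [← h22, lintegral_map (by fun_prop) measurable_snd]
    have hπτ (F : ℝ → ENNReal) (hF : Measurable F) : ∫⁻ v, F v.2 ∂(π₂.prod τ) = ∫⁻ u, F u ∂τ := by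
      rw [← lintegral_map hF measurable_snd, Measure.map_snd_prod]
      simp
    have hAB (F : ℝ × ℝ → ENNReal) (H : ℝ → ENNReal) (hF : Measurable F) (hH : Measurable H) :
        ∫⁻ w, F w.1 * H w.2.2 ∂(π₁.prod (π₂.prod τ)) = (∫⁻ z, F z ∂π₁) * ∫⁻ u, H u ∂τ := by
      rw [← hπτ H hH]
      exact lintegral_prod_mul (g := fun v : (ℝ × ℝ) × ℝ => H v.2) hF.aemeasurable
        (hH.comp measurable_snd).aemeasurable
    have hsnd (F : (ℝ × ℝ) × ℝ → ENNReal) (hF : Measurable F) :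
        ∫⁻ w, F w.2 ∂(π₁.prod (π₂.prod τ)) = ∫⁻ v, F v ∂(π₂.prod τ) := by
      rw [← lintegral_map hF measurable_snd, Measure.map_snd_prod]
      simp
    have hBB (F : ℝ × ℝ → ENNReal) (H : ℝ → ENNReal) (hF : Measurable F) (hH : Measurable H) :
        ∫⁻ w, F w.2.1 * H w.2.2 ∂(π₁.prod (π₂.prod τ)) = (∫⁻ z, F z ∂π₂) * ∫⁻ u, H u ∂τ := by
      rw [hsnd (fun v => F v.1 * H v.2) (by fun_prop)]
      exact lintegral_prod_mul hF.aemeasurable hH.aemeasurable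
    rw [hAB (fun z => ENNReal.ofReal |z.1 - z.2|) (fun u => ENNReal.ofReal (a u)) (by fun_prop)
        (by fun_prop),
      hBB (fun z => ENNReal.ofReal |z.1 - z.2|) (fun u => ENNReal.ofReal (b u)) (by fun_prop)
        (by fun_prop),
      hAB (fun z => ENNReal.ofReal |z.2|) (fun u => ENNReal.ofReal |a u - a' u|) (by fun_prop)
        (by fun_prop),
      hBB (fun z => ENNReal.ofReal |z.2|) (fun u => ENNReal.ofReal |b u - b' u|) (by fun_prop)
        (by fun_prop), m1, m2,
      hsnd (fun v => ENNReal.ofReal |t v.2 - t' v.2|) (by fun_prop),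
      hπτ (fun u => ENNReal.ofReal |t u - t' u|) (by fun_prop)]
    gcongr

/-- The easy half of the duality between `d₁` and Lipschitz functions. -/
theorem dist_integral_le_of_coupledWithin {μ ν : Measure ℝ} [IsProbabilityMeasure μ]
    [IsProbabilityMeasure ν] {r : ℝ} (hr : 0 ≤ r) (h : CoupledWithin μ ν r) {f : ℝ → ℝ} {C : ℝ}
    (hC : ∀ x y, dist (f x) (f y) ≤ C) {L : NNReal} (hL : LipschitzWith L f) :
    dist (∫ x, f x ∂μ) (∫ x, f x ∂ν) ≤ L * r := by
  obtain ⟨π, h1, h2, h3⟩ := h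
  have i1 := isProbabilityMeasure_of_map measurable_fst h1
  have hfm : Measurable f := hL.continuous.measurable
  have hb : ∀ x, ‖f x‖ ≤ C + ‖f 0‖ := fun x => by
    have := hC x 0
    rw [dist_eq_norm] at this
    have h' := norm_add_le (f x - f 0) (f 0)
    rw [sub_add_cancel] at h'
    linarith
  have g1 : Integrable (fun z : ℝ × ℝ => f z.1) π :=
    Integrable.of_bound (hfm.comp measurable_fst).aestronglyMeasurable _ (ae_of_all _ fun z => hb _)
  have g2 : Integrable (fun z : ℝ × ℝ => f z.2) π :=
    Integrable.of_bound (hfm.comp measurable_snd).aestronglyMeasurable _ (ae_of_all _ fun z => hb _)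
  rw [← h1, ← h2, integral_map measurable_fst.aemeasurable hfm.aestronglyMeasurable,
    integral_map measurable_snd.aemeasurable hfm.aestronglyMeasurable, dist_eq_norm,
    ← integral_sub g1 g2]
  rw [← ENNReal.ofReal_le_ofReal_iff (by positivity)]
  refine (ENNReal.ofReal_le_ofReal (norm_integral_le_lintegral_norm _)).trans ?_
  refine ENNReal.ofReal_toReal_le.trans ?_
  calc ∫⁻ z, ENNReal.ofReal ‖f z.1 - f z.2‖ ∂π
      ≤ ∫⁻ z, ENNReal.ofReal L * ENNReal.ofReal |z.1 - z.2| ∂π := by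
        refine lintegral_mono fun z => ?_
        rw [← ENNReal.ofReal_mul L.coe_nonneg, ← Real.dist_eq, ← dist_eq_norm]
        exact ENNReal.ofReal_le_ofReal (hL.dist_le_mul _ _)
    _ = ENNReal.ofReal L * ∫⁻ z, ENNReal.ofReal |z.1 - z.2| ∂π :=
        lintegral_const_mul _ (by fun_prop)
    _ ≤ ENNReal.ofReal (L * r) := by
        rw [ENNReal.ofReal_mul L.coe_nonneg]
        gcongr

theorem tendsto_of_eventually_coupledWithin {γ : Type*} {F : Filter γ} [F.IsCountablyGenerated]
    {μs : γ → ProbabilityMeasure ℝ} {μ : ProbabilityMeasure ℝ}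
    (h : ∀ ε > 0, ∀ᶠ i in F, CoupledWithin (μs i) μ ε) : Tendsto μs F (𝓝 μ) := by
  rw [tendsto_iff_forall_lipschitz_integral_tendsto]
  rintro f ⟨C, hC⟩ ⟨L, hL⟩
  rw [Metric.tendsto_nhds]
  intro ε hε
  have hL0 : (0 : ℝ) ≤ L := L.2
  filter_upwards [h (ε / (L + 1)) (by positivity)] with i hi
  refine (dist_integral_le_of_coupledWithin (by positivity) hi hC hL).trans_lt ?_
  rw [mul_div_assoc', div_lt_iff₀ (by positivity)]
  nlinarith

theorem tendsto_wassersteinDist {γ : Type*} {F : Filter γ}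
    {μs : γ → ProbabilityMeasure ℝ} {μ : ProbabilityMeasure ℝ}
    (h : ∀ ε > 0, ∀ᶠ i in F, CoupledWithin (μs i) μ ε) :
    Tendsto (fun i => wassersteinDist (μs i : Measure ℝ) (μ : Measure ℝ)) F (𝓝 0) := by
  rw [ENNReal.tendsto_nhds_zero]
  intro ε hε
  obtain ⟨δ, hδ0, hδ⟩ := ENNReal.lt_iff_exists_nnreal_btwn.1 hε
  filter_upwards [h δ (by simpa using hδ0)] with i hi
  refine hi.wassersteinDist_le.trans ?_
  rw [ENNReal.ofReal_coe_nnreal]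
  exact hδ.le

theorem eq_of_coupledWithin {μ ν : ProbabilityMeasure ℝ} (h : ∀ ε > 0, CoupledWithin μ ν ε) :
    μ = ν :=
  tendsto_nhds_unique (tendsto_const_nhds (f := (atTop : Filter ℕ)))
    (tendsto_of_eventually_coupledWithin fun ε hε => Eventually.of_forall fun _ => h ε hε)

end

/-! ### The distributional equation -/

noncomputable section

/-- The coefficient `[(1 - 2c) u + c]²` of the left sublist. -/
def leftCoeff (c u : ℝ) : ℝ := ((1 - 2 * c) * u + c) ^ 2

/-- The coefficient `[(2c - 1) u + 1 - c]²` of the right sublist. -/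
def rightCoeff (c u : ℝ) : ℝ := ((2 * c - 1) * u + 1 - c) ^ 2

/-- The uniform law on `[0, 1]`. -/
abbrev uniformLaw : Measure ℝ := volume.restrict (Set.Icc (0 : ℝ) 1)

instance : IsProbabilityMeasure uniformLaw := ⟨by simp [uniformLaw]⟩

theorem recursionLaw_eq (c : ℝ) (μ : Measure ℝ) :
    recursionLaw c μ = combinationLaw μ μ uniformLaw (leftCoeff c) (rightCoeff c) (toll c) := rfl

theorem continuous_leftCoeff (c : ℝ) : Continuous (leftCoeff c) := by
  unfold leftCoeff; fun_prop

theorem continuous_rightCoeff (c : ℝ) : Continuous (rightCoeff c) := by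
  unfold rightCoeff; fun_prop

theorem continuous_toll (c : ℝ) : Continuous (toll c) := by
  unfold toll; fun_prop

theorem integral_uniformLaw_mul (a b d a' b' d' : ℝ) :
    ∫ u, (a + b * u + d * u ^ 2) * (a' + b' * u + d' * u ^ 2) ∂uniformLaw =
      a * a' + (a * b' + b * a') / 2 + (a * d' + b * b' + d * a') / 3 + (b * d' + d * b') / 4 +
        d * d' / 5 := by
  rw [uniformLaw, integral_Icc_eq_integral_Ioc, ← intervalIntegral.integral_of_le zero_le_one]
  have hd (u : ℝ) : HasDerivAt (fun u : ℝ => a * a' * u + (a * b' + b * a') / 2 * u ^ 2 +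
      (a * d' + b * b' + d * a') / 3 * u ^ 3 + (b * d' + d * b') / 4 * u ^ 4 + d * d' / 5 * u ^ 5)
      ((a + b * u + d * u ^ 2) * (a' + b' * u + d' * u ^ 2)) u := by
    have h := (((((hasDerivAt_id u).const_mul (a * a')).add
      ((hasDerivAt_pow 2 u).const_mul ((a * b' + b * a') / 2))).add
      ((hasDerivAt_pow 3 u).const_mul ((a * d' + b * b' + d * a') / 3))).add
      ((hasDerivAt_pow 4 u).const_mul ((b * d' + d * b') / 4))).add
      ((hasDerivAt_pow 5 u).const_mul (d * d' / 5))
    refine h.congr_deriv ?_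
    push_cast
    ring
  rw [intervalIntegral.integral_eq_sub_of_hasDerivAt (fun u _ => hd u)
    (Continuous.intervalIntegrable (by fun_prop) _ _)]
  ring

theorem leftCoeff_eq (c u : ℝ) :
    leftCoeff c u = c ^ 2 + (2 * c * (1 - 2 * c)) * u + (1 - 2 * c) ^ 2 * u ^ 2 := by
  unfold leftCoeff; ring

theorem rightCoeff_eq (c u : ℝ) : rightCoeff c u =
    (1 - c) ^ 2 + (2 * (1 - c) * (2 * c - 1)) * u + (1 - 2 * c) ^ 2 * u ^ 2 := by
  unfold rightCoeff; ring

theorem toll_eq (c u : ℝ) :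
    toll c u = (1 - c) / 2 + (2 * c - 1) * u + (1 - 2 * c) * u ^ 2 := by
  unfold toll; ring

theorem leftCoeff_nonneg (c u : ℝ) : 0 ≤ leftCoeff c u := sq_nonneg _

theorem rightCoeff_nonneg (c u : ℝ) : 0 ≤ rightCoeff c u := sq_nonneg _

theorem toll_nonneg {c u : ℝ} (hc : c ∈ Set.Icc (0 : ℝ) 1) (hu : u ∈ Set.Icc (0 : ℝ) 1) :
    0 ≤ toll c u := by
  have := sub_nonneg.2 hc.2
  have := sub_nonneg.2 hu.2
  have := hc.1
  have := hu.1
  unfold toll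
  positivity

/-- The sum of the squares of the relative sublist sizes is largest without errors. -/
theorem leftCoeff_add_rightCoeff_le {c u : ℝ} (hc : c ∈ Set.Icc (0 : ℝ) 1) :
    leftCoeff c u + rightCoeff c u ≤ u ^ 2 + (1 - u) ^ 2 := by
  have : u ^ 2 + (1 - u) ^ 2 - (leftCoeff c u + rightCoeff c u) =
      2 * (c * (1 - c)) * (2 * u - 1) ^ 2 := by
    unfold leftCoeff rightCoeff; ring
  have h := mul_nonneg (mul_nonneg zero_le_two (mul_nonneg hc.1 (sub_nonneg.2 hc.2)))
    (sq_nonneg (2 * u - 1))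
  linarith

theorem lintegral_leftCoeff_add_rightCoeff_le {c : ℝ} (hc : c ∈ Set.Icc (0 : ℝ) 1) :
    ∫⁻ u, ENNReal.ofReal (leftCoeff c u) ∂uniformLaw +
      ∫⁻ u, ENNReal.ofReal (rightCoeff c u) ∂uniformLaw ≤ ENNReal.ofReal (2 / 3) := by
  have hm := (continuous_leftCoeff c).measurable
  rw [← lintegral_add_left (by fun_prop)]
  have h : ∀ u, ENNReal.ofReal (leftCoeff c u) + ENNReal.ofReal (rightCoeff c u) ≤
      ENNReal.ofReal (u ^ 2 + (1 - u) ^ 2) := fun u => by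
    rw [← ENNReal.ofReal_add (leftCoeff_nonneg _ _) (rightCoeff_nonneg _ _)]
    exact ENNReal.ofReal_le_ofReal (leftCoeff_add_rightCoeff_le hc)
  refine (lintegral_mono h).trans ?_
  rw [← ofReal_integral_eq_lintegral_ofReal]
  · refine ENNReal.ofReal_le_ofReal (le_of_eq ?_)
    have := integral_uniformLaw_mul 1 (-2) 2 1 0 0
    rw [integral_congr_ae (ae_of_all _ fun u : ℝ => show u ^ 2 + (1 - u) ^ 2 =
      (1 + -2 * u + 2 * u ^ 2) * (1 + 0 * u + 0 * u ^ 2) by ring), this]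
    norm_num
  · exact (Continuous.continuousOn (by fun_prop)).integrableOn_Icc
  · exact ae_of_all _ fun u => by positivity

/-- The right hand side of the distributional equation is a contraction. -/
theorem CoupledWithin.recursionLaw {c : ℝ} (hc : c ∈ Set.Icc (0 : ℝ) 1) {μ ν : Measure ℝ}
    [IsProbabilityMeasure μ] [IsProbabilityMeasure ν] {r : ℝ} (hr : 0 ≤ r)
    (h : CoupledWithin μ ν r) :
    CoupledWithin (recursionLaw c μ) (recursionLaw c ν) (2 / 3 * r) := by
  have m1 := (continuous_leftCoeff c).measurable
  have m2 := (continuous_rightCoeff c).measurable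
  have m3 := (continuous_toll c).measurable
  rw [recursionLaw_eq, recursionLaw_eq]
  refine coupledWithin_combinationLaw m1 m2 m3 m1 m2 m3 (leftCoeff_nonneg c) (rightCoeff_nonneg c)
    h h ?_
  simp only [sub_self, abs_zero, ENNReal.ofReal_zero, lintegral_zero, mul_zero, add_zero]
  rw [← mul_add, mul_comm (2 / 3 : ℝ), ENNReal.ofReal_mul hr]
  gcongr
  exact lintegral_leftCoeff_add_rightCoeff_le hc

theorem isProbabilityMeasure_recursionLaw (c : ℝ) (μ : Measure ℝ) [IsProbabilityMeasure μ] :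
    IsProbabilityMeasure (recursionLaw c μ) := by
  have m1 := (continuous_leftCoeff c).measurable
  have m2 := (continuous_rightCoeff c).measurable
  have m3 := (continuous_toll c).measurable
  rw [recursionLaw_eq, combinationLaw]
  exact Measure.isProbabilityMeasure_map (by fun_prop)

theorem isFiniteMeanSolution_unique {c : ℝ} (hc : c ∈ Set.Icc (0 : ℝ) 1)
    {μ ν : ProbabilityMeasure ℝ} (hμ : IsFiniteMeanSolution c μ) (hν : IsFiniteMeanSolution c ν) :
    μ = ν := by
  set r := ∫ x, |x| ∂(μ : Measure ℝ) + ∫ x, |x| ∂(ν : Measure ℝ) with hr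
  have hr0 : 0 ≤ r :=
    add_nonneg (integral_nonneg fun _ => abs_nonneg _) (integral_nonneg fun _ => abs_nonneg _)
  have key (k : ℕ) : CoupledWithin (μ : Measure ℝ) ν ((2 / 3) ^ k * r) := by
    induction k with
    | zero => simpa using coupledWithin_of_integrable hμ.1 hν.1
    | succ k ih =>
      have := ih.recursionLaw hc (by positivity)
      rwa [hμ.2, hν.2, ← mul_assoc, ← pow_succ'] at this
  refine eq_of_coupledWithin fun ε hε => ?_
  have hlim : Tendsto (fun k : ℕ => (2 / 3 : ℝ) ^ k * r) atTop (𝓝 (0 * r)) :=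
    (tendsto_pow_atTop_nhds_zero_of_lt_one (by norm_num) (by norm_num)).mul_const r
  rw [zero_mul] at hlim
  obtain ⟨k, hk⟩ := (hlim.eventually_lt_const hε).exists
  exact (key k).mono hk.le

/-- The bound `2 / c` is preserved by the distributional equation. -/
theorem leftCoeff_mul_add_le {c u x y : ℝ} (hc0 : 0 < c) (hc1 : c ≤ 1)
    (hu : u ∈ Set.Icc (0 : ℝ) 1) (hx : x ∈ Set.Icc 0 (2 / c)) (hy : y ∈ Set.Icc 0 (2 / c)) :
    leftCoeff c u * x + rightCoeff c u * y + toll c u ∈ Set.Icc 0 (2 / c) := by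
  have h1 := leftCoeff_nonneg c u
  have h2 := rightCoeff_nonneg c u
  have h3 := toll_nonneg ⟨hc0.le, hc1⟩ hu
  constructor
  · have := mul_nonneg h1 hx.1
    have := mul_nonneg h2 hy.1
    linarith
  have h4 := mul_le_mul_of_nonneg_left hx.2 h1
  have h5 := mul_le_mul_of_nonneg_left hy.2 h2
  suffices h : toll c u ≤ (1 - (leftCoeff c u + rightCoeff c u)) * (2 / c) by linarith
  rw [mul_div_assoc', le_div_iff₀ hc0]
  set v := u * (1 - u) with hv
  have hv0 : 0 ≤ v := mul_nonneg hu.1 (sub_nonneg.2 hu.2)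
  have hv1 : v ≤ 1 / 4 := by nlinarith [sq_nonneg (2 * u - 1)]
  have e1 : toll c u = (1 - c) / 2 + (2 * c - 1) * v := by rw [hv, toll]; ring
  have e2 : 1 - (leftCoeff c u + rightCoeff c u) = 2 * (c * (1 - c) + (2 * c - 1) ^ 2 * v) := by
    rw [hv]; unfold leftCoeff rightCoeff; ring
  rw [e1, e2]
  have h6 : (2 * c - 1) * c ≤ 4 * (2 * c - 1) ^ 2 + 2 * (c * (1 - c)) := by
    nlinarith [sq_nonneg (2 * c - 1), sq_nonneg (c - 1), mul_nonneg hc0.le (sub_nonneg.2 hc1)]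
  have h7 := mul_le_mul_of_nonneg_right h6 hv0
  have h8 := mul_nonneg hc0.le (sub_nonneg.2 hc1)
  nlinarith [mul_le_mul_of_nonneg_left hv1 h8]

theorem ae_recursionLaw {c : ℝ} (hc0 : 0 < c) (hc1 : c ≤ 1) {μ : Measure ℝ}
    [IsProbabilityMeasure μ] (hμ : ∀ᵐ x ∂μ, x ∈ Set.Icc 0 (2 / c)) :
    ∀ᵐ x ∂(recursionLaw c μ), x ∈ Set.Icc 0 (2 / c) := by
  have m1 := (continuous_leftCoeff c).measurable
  have m2 := (continuous_rightCoeff c).measurable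
  have m3 := (continuous_toll c).measurable
  have hI : MeasurableSet {x : ℝ | x ∈ Set.Icc 0 (2 / c)} := measurableSet_Icc
  rw [recursionLaw_eq, combinationLaw, ae_map_iff (by fun_prop) hI]
  have hu : ∀ᵐ u ∂uniformLaw, u ∈ Set.Icc (0 : ℝ) 1 := ae_restrict_mem measurableSet_Icc
  have q1 := Measure.quasiMeasurePreserving_fst (μ := μ) (ν := μ.prod uniformLaw)
  have q2 := Measure.quasiMeasurePreserving_snd (μ := μ) (ν := μ.prod uniformLaw)
  have q3 := Measure.quasiMeasurePreserving_fst (μ := μ) (ν := uniformLaw)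
  have q4 := Measure.quasiMeasurePreserving_snd (μ := μ) (ν := uniformLaw)
  filter_upwards [q1.ae hμ, (q3.comp q2).ae hμ, (q4.comp q2).ae hu] with w h1 h2 h3
  exact leftCoeff_mul_add_le hc0 hc1 h3 h1 h2

/-- The right hand side of the distributional equation as a map on probability measures. -/
def recursionMap (c : ℝ) (μ : ProbabilityMeasure ℝ) : ProbabilityMeasure ℝ :=
  ⟨recursionLaw c μ, isProbabilityMeasure_recursionLaw c μ⟩

theorem continuous_recursionMap (c : ℝ) : Continuous (recursionMap c) := by
  have m1 := continuous_leftCoeff c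
  have m2 := continuous_rightCoeff c
  have m3 := continuous_toll c
  let ρ : ProbabilityMeasure ℝ := ⟨uniformLaw, inferInstance⟩
  let g : ℝ × ℝ × ℝ → ℝ :=
    fun w => leftCoeff c w.2.2 * w.1 + rightCoeff c w.2.2 * w.2.1 + toll c w.2.2
  have hg : Continuous g := by fun_prop
  have h1 : Continuous fun μ : ProbabilityMeasure ℝ => μ.prod (μ.prod ρ) :=
    ProbabilityMeasure.continuous_prod.comp (continuous_id.prodMk
      (ProbabilityMeasure.continuous_prod.comp (continuous_id.prodMk continuous_const)))
  exact (ProbabilityMeasure.continuous_map hg).comp h1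

/-- A limit point of the iterates which start at `δ₀` is a solution: they stay in a compact set of
laws, and by the contraction property consecutive iterates approach each other. -/
theorem exists_solution {c : ℝ} (hc0 : 0 < c) (hc1 : c ≤ 1) : ∃ μ : ProbabilityMeasure ℝ,
    (∀ᵐ x ∂(μ : Measure ℝ), x ∈ Set.Icc 0 (2 / c)) ∧ recursionMap c μ = μ := by
  have hc : c ∈ Set.Icc (0 : ℝ) 1 := ⟨hc0.le, hc1⟩
  let S : Set (ProbabilityMeasure ℝ) := {μ | ∀ _ : ℕ, μ (Set.Icc 0 (2 / c))ᶜ ≤ 0}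
  have hS : IsCompact S := isCompact_setOfPred_probabilityMeasure_mass_eq_compl_isCompact_le
    (u := fun _ => 0) (K := fun _ => Set.Icc 0 (2 / c)) tendsto_const_nhds
    (fun _ => isCompact_Icc) (Or.inr monotone_const)
  have hSmem (μ : ProbabilityMeasure ℝ) :
      μ ∈ S ↔ ∀ᵐ x ∂(μ : Measure ℝ), x ∈ Set.Icc 0 (2 / c) := by
    simp only [S, Set.mem_ofPred_eq, forall_const, nonpos_iff_eq_zero]
    rw [ProbabilityMeasure.null_iff_toMeasure_null, ae_iff]
    rfl
  let μs : ℕ → ProbabilityMeasure ℝ :=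
    fun k => (recursionMap c)^[k] ⟨Measure.dirac 0, inferInstance⟩
  have hstep (k : ℕ) : μs (k + 1) = recursionMap c (μs k) := Function.iterate_succ_apply' _ _ _
  have hμs (k : ℕ) : μs k ∈ S := by
    rw [hSmem]
    induction k with
    | zero =>
      change ∀ᵐ x ∂(Measure.dirac (0 : ℝ)), x ∈ Set.Icc 0 (2 / c)
      have hI : MeasurableSet {x : ℝ | x ∈ Set.Icc 0 (2 / c)} := measurableSet_Icc
      rw [ae_dirac_iff hI]
      exact ⟨le_rfl, by positivity⟩
    | succ k ih =>
      rw [hstep]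
      exact ae_recursionLaw hc0 hc1 ih
  obtain ⟨r, hr0, hr⟩ : ∃ r, 0 ≤ r ∧ CoupledWithin (μs 0) (μs 1) r := by
    have hint (k : ℕ) : Integrable (fun x : ℝ => x) (μs k) := by
      refine Integrable.of_bound measurable_id.aestronglyMeasurable (2 / c) ?_
      filter_upwards [(hSmem _).1 (hμs k)] with x hx
      rw [Real.norm_eq_abs, abs_of_nonneg hx.1]
      exact hx.2
    exact ⟨_, add_nonneg (integral_nonneg fun _ => abs_nonneg _)
      (integral_nonneg fun _ => abs_nonneg _), coupledWithin_of_integrable (hint 0) (hint 1)⟩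
  have hcoup (k : ℕ) : CoupledWithin (μs k) (μs (k + 1)) ((2 / 3) ^ k * r) := by
    induction k with
    | zero => simpa using hr
    | succ k ih =>
      have := ih.recursionLaw hc (by positivity)
      rw [hstep k, hstep (k + 1), pow_succ', mul_assoc]
      rwa [hstep k] at this ⊢
  obtain ⟨μ, hμ, φ, hφ, hlim⟩ := hS.tendsto_subseq hμs
  refine ⟨μ, (hSmem μ).1 hμ, ?_⟩
  have hlim2 : Tendsto (fun k => recursionMap c (μs (φ k))) atTop (𝓝 (recursionMap c μ)) :=
    ((continuous_recursionMap c).tendsto μ).comp hlim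
  refine tendsto_nhds_unique hlim2 ?_
  rw [tendsto_iff_forall_lipschitz_integral_tendsto] at hlim ⊢
  rintro f ⟨C, hC⟩ ⟨L, hL⟩
  refine (tendsto_iff_of_dist ?_).1 (hlim f ⟨C, hC⟩ ⟨L, hL⟩)
  have hpow : Tendsto (fun k : ℕ => (L : ℝ) * ((2 / 3 : ℝ) ^ k * r)) atTop (𝓝 (L * (0 * r))) :=
    ((tendsto_pow_atTop_nhds_zero_of_lt_one (by norm_num) (by norm_num)).mul_const r).const_mul _
  rw [zero_mul, mul_zero] at hpow
  refine squeeze_zero (fun _ => dist_nonneg) (fun k => ?_) (hpow.comp hφ.tendsto_atTop)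
  have := hcoup (φ k)
  rw [hstep] at this
  exact dist_integral_le_of_coupledWithin (by positivity) this hC hL

end

/-! ### Mean and variance of the solution -/

noncomputable section

/-- `F` is integrable with integral `v`. -/
def HasMean {γ : Type*} [MeasurableSpace γ] (π : Measure γ) (F : γ → ℝ) (v : ℝ) : Prop :=
  Integrable F π ∧ ∫ w, F w ∂π = v

theorem HasMean.add {γ : Type*} [MeasurableSpace γ] {π : Measure γ} {F G : γ → ℝ} {v w : ℝ}
    (hF : HasMean π F v) (hG : HasMean π G w) : HasMean π (fun x => F x + G x) (v + w) :=
  ⟨hF.1.add hG.1, by rw [integral_add hF.1 hG.1, hF.2, hG.2]⟩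

theorem hasMean_mul_mul {μ ν τ : Measure ℝ} [SFinite μ] [SFinite ν] [SFinite τ]
    {f g h : ℝ → ℝ} (hf : Integrable f μ) (hg : Integrable g ν) (hh : Integrable h τ) :
    HasMean (μ.prod (ν.prod τ)) (fun w : ℝ × ℝ × ℝ => f w.1 * (g w.2.1 * h w.2.2))
      ((∫ x, f x ∂μ) * ((∫ y, g y ∂ν) * ∫ u, h u ∂τ)) := by
  refine ⟨hf.mul_prod (hg.mul_prod hh), ?_⟩
  rw [integral_prod_mul (μ := μ) (ν := ν.prod τ) f (fun v => g v.1 * h v.2), integral_prod_mul]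

theorem integrable_uniformLaw {h : ℝ → ℝ} (hh : Continuous h) : Integrable h uniformLaw :=
  hh.continuousOn.integrableOn_Icc

theorem integral_recursionLaw {c : ℝ} {μ : Measure ℝ} [IsProbabilityMeasure μ]
    (h1 : Integrable (fun x : ℝ => x) μ) :
    ∫ x, x ∂(recursionLaw c μ) =
      (∫ x, x ∂μ) * (∫ u, leftCoeff c u ∂uniformLaw + ∫ u, rightCoeff c u ∂uniformLaw) +
        ∫ u, toll c u ∂uniformLaw := by
  have m1 := continuous_leftCoeff c
  have m2 := continuous_rightCoeff c
  have m3 := continuous_toll c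
  have hone : Integrable (fun _ : ℝ => (1 : ℝ)) μ := integrable_const 1
  rw [recursionLaw_eq, combinationLaw, integral_map (by fun_prop) (by fun_prop)]
  have h := ((hasMean_mul_mul h1 hone (integrable_uniformLaw m1)).add
    (hasMean_mul_mul hone h1 (integrable_uniformLaw m2))).add
    (hasMean_mul_mul hone hone (integrable_uniformLaw m3))
  refine Eq.trans (integral_congr_ae (ae_of_all _ fun w => ?_)) (h.2.trans ?_)
  · ring
  · simp only [integral_const, probReal_univ, smul_eq_mul, one_mul]
    ring

theorem integral_sq_recursionLaw {c : ℝ} {μ : Measure ℝ} [IsProbabilityMeasure μ]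
    (h1 : Integrable (fun x : ℝ => x) μ) (h2 : Integrable (fun x : ℝ => x ^ 2) μ) :
    ∫ x, x ^ 2 ∂(recursionLaw c μ) =
      (∫ x, x ^ 2 ∂μ) * (∫ u, leftCoeff c u * leftCoeff c u ∂uniformLaw +
        ∫ u, rightCoeff c u * rightCoeff c u ∂uniformLaw) +
      2 * (∫ x, x ∂μ) ^ 2 * ∫ u, leftCoeff c u * rightCoeff c u ∂uniformLaw +
      2 * (∫ x, x ∂μ) * (∫ u, leftCoeff c u * toll c u ∂uniformLaw +
        ∫ u, rightCoeff c u * toll c u ∂uniformLaw) +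
      ∫ u, toll c u * toll c u ∂uniformLaw := by
  have m1 := continuous_leftCoeff c
  have m2 := continuous_rightCoeff c
  have m3 := continuous_toll c
  have hone : Integrable (fun _ : ℝ => (1 : ℝ)) μ := integrable_const 1
  have htwo : Integrable (fun _ : ℝ => (2 : ℝ)) μ := integrable_const 2
  have hx2 : Integrable (fun x : ℝ => 2 * x) μ := h1.const_mul 2
  rw [recursionLaw_eq, combinationLaw, integral_map (by fun_prop) (by fun_prop)]
  have h := (((((hasMean_mul_mul h2 hone (integrable_uniformLaw (m1.mul m1))).add
    (hasMean_mul_mul hone h2 (integrable_uniformLaw (m2.mul m2)))).add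
    (hasMean_mul_mul hone hone (integrable_uniformLaw (m3.mul m3)))).add
    (hasMean_mul_mul h1 hx2 (integrable_uniformLaw (m1.mul m2)))).add
    (hasMean_mul_mul h1 htwo (integrable_uniformLaw (m1.mul m3)))).add
    (hasMean_mul_mul htwo h1 (integrable_uniformLaw (m2.mul m3)))
  refine Eq.trans (integral_congr_ae (ae_of_all _ fun w => ?_)) (h.2.trans ?_)
  · simp only [Pi.mul_apply]
    ring
  · have e2 : ∫ x, 2 * x ∂μ = 2 * ∫ x, x ∂μ := integral_const_mul 2 _
    simp only [integral_const, probReal_univ, smul_eq_mul, one_mul, e2, Pi.mul_apply]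
    ring

theorem integral_eq_of_recursionLaw_eq {c : ℝ} (hc : c ∈ Set.Icc (0 : ℝ) 1) {μ : Measure ℝ}
    [IsProbabilityMeasure μ] (h1 : Integrable (fun x : ℝ => x) μ) (hμ : recursionLaw c μ = μ) :
    ∫ x, x ∂μ = (2 - c) / (2 * (1 + 2 * c - 2 * c ^ 2)) := by
  have h := integral_recursionLaw (c := c) h1
  have I (f : ℝ → ℝ) (a b d : ℝ) (hf : ∀ u, f u = a + b * u + d * u ^ 2) :
      ∫ u, f u ∂uniformLaw = a + b / 2 + d / 3 := by
    have := integral_uniformLaw_mul a b d 1 0 0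
    rw [integral_congr_ae (ae_of_all _ fun u : ℝ => show f u =
      (a + b * u + d * u ^ 2) * (1 + 0 * u + 0 * u ^ 2) by rw [hf]; ring), this]
    ring
  rw [hμ, I _ _ _ _ (leftCoeff_eq c), I _ _ _ _ (rightCoeff_eq c), I _ _ _ _ (toll_eq c)] at h
  have hd : 0 < 1 + 2 * c - 2 * c ^ 2 := by nlinarith [mul_nonneg hc.1 (sub_nonneg.2 hc.2)]
  rw [eq_div_iff (by positivity)]
  linear_combination 6 * h

theorem integral_sq_eq_of_recursionLaw_eq {c : ℝ} (hc : c ∈ Set.Icc (0 : ℝ) 1) {μ : Measure ℝ}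
    [IsProbabilityMeasure μ] (h1 : Integrable (fun x : ℝ => x) μ)
    (h2 : Integrable (fun x : ℝ => x ^ 2) μ) (hμ : recursionLaw c μ = μ) :
    ∫ x, x ^ 2 ∂μ - (∫ x, x ∂μ) ^ 2 = (1 - c) ^ 2 * (1 - 2 * c) ^ 2 /
      (4 * (1 + 2 * c - 2 * c ^ 2) ^ 2 * (3 + 6 * c - 8 * c ^ 2 + 4 * c ^ 3 - 2 * c ^ 4)) := by
  have hm := integral_eq_of_recursionLaw_eq hc h1 hμ
  have h := integral_sq_recursionLaw (c := c) h1 h2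
  have I (f g : ℝ → ℝ) (a b d a' b' d' : ℝ) (hf : ∀ u, f u = a + b * u + d * u ^ 2)
      (hg : ∀ u, g u = a' + b' * u + d' * u ^ 2) : ∫ u, f u * g u ∂uniformLaw =
      a * a' + (a * b' + b * a') / 2 + (a * d' + b * b' + d * a') / 3 + (b * d' + d * b') / 4 +
        d * d' / 5 := by
    rw [← integral_uniformLaw_mul]
    simp only [hf, hg]
  rw [hμ, I _ _ _ _ _ _ _ _ (leftCoeff_eq c) (leftCoeff_eq c),
    I _ _ _ _ _ _ _ _ (rightCoeff_eq c) (rightCoeff_eq c),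
    I _ _ _ _ _ _ _ _ (leftCoeff_eq c) (rightCoeff_eq c),
    I _ _ _ _ _ _ _ _ (leftCoeff_eq c) (toll_eq c),
    I _ _ _ _ _ _ _ _ (rightCoeff_eq c) (toll_eq c),
    I _ _ _ _ _ _ _ _ (toll_eq c) (toll_eq c)] at h
  have hd : 0 < 1 + 2 * c - 2 * c ^ 2 := by nlinarith [mul_nonneg hc.1 (sub_nonneg.2 hc.2)]
  have hd2 : 0 < 3 + 6 * c - 8 * c ^ 2 + 4 * c ^ 3 - 2 * c ^ 4 := by
    have e : 3 + 6 * c - 8 * c ^ 2 + 4 * c ^ 3 - 2 * c ^ 4 =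
      3 + 6 * (c * (1 - c)) - 2 * c ^ 2 * (1 - c) ^ 2 := by ring
    have h1 : c * (1 - c) ≤ 1 := by nlinarith [hc.1, hc.2]
    have h0 := mul_nonneg hc.1 (sub_nonneg.2 hc.2)
    rw [e]
    nlinarith
  set m := ∫ x, x ∂μ
  set m₂ := ∫ x, x ^ 2 ∂μ
  have hm' : m * (2 * (1 + 2 * c - 2 * c ^ 2)) = 2 - c := by
    rw [hm]; field_simp
  have hsq : m ^ 2 * (2 * (1 + 2 * c - 2 * c ^ 2)) ^ 2 = (2 - c) ^ 2 := by rw [← mul_pow, hm']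
  have h' : m₂ * (3 + 6 * c - 8 * c ^ 2 + 4 * c ^ 3 - 2 * c ^ 4) *
      (2 * (1 + 2 * c - 2 * c ^ 2)) ^ 2 = (1 - c) ^ 2 * (1 - 2 * c) ^ 2 +
      (2 - c) ^ 2 * (3 + 6 * c - 8 * c ^ 2 + 4 * c ^ 3 - 2 * c ^ 4) := by
    -- the polynomials in `c` are the mixed second moments of the coefficients and the toll
    linear_combination 5 * (2 * (1 + 2 * c - 2 * c ^ 2)) ^ 2 * h +
      10 * (1 / 30 + c / 15 + 2 / 15 * c ^ 2 - 2 / 5 * c ^ 3 + c ^ 4 / 5) * hsq +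
      10 * (2 * (1 + 2 * c - 2 * c ^ 2)) * (7 / 30 - 2 / 5 * c + 7 / 15 * c ^ 2 - c ^ 3 / 5) * hm'
  rw [eq_div_iff (by positivity)]
  linear_combination h' - (3 + 6 * c - 8 * c ^ 2 + 4 * c ^ 3 - 2 * c ^ 4) * hsq

end

/-! ### The recursion for the scaled law -/

noncomputable section

theorem toMeasure_bind_eq_sum {ι γ : Type*} [MeasurableSpace γ] (P : PMF ι) (f : ι → PMF γ) :
    (P.bind f).toMeasure = Measure.sum fun i => P i • (f i).toMeasure := by
  ext s hs
  rw [PMF.toMeasure_bind_apply _ _ _ hs, Measure.sum_apply _ hs]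
  simp

theorem coupledWithin_bind {ι : Type*} (P : PMF ι) (f : ι → PMF ℝ) (ν : ι → Measure ℝ)
    (r : ι → ℝ) (R : ℝ) (h : ∀ i, CoupledWithin (f i).toMeasure (ν i) (r i))
    (hR : ∑' i, P i * ENNReal.ofReal (r i) ≤ ENNReal.ofReal R) :
    CoupledWithin (P.bind f).toMeasure (Measure.sum fun i => P i • ν i) R := by
  rw [toMeasure_bind_eq_sum]
  exact CoupledWithin.sum _ _ _ _ _ h hR

theorem sum_pmf_smul {ι γ : Type*} [MeasurableSpace γ] (P : PMF ι) (ν : Measure γ) :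
    (Measure.sum fun i => P i • ν) = ν := by
  ext s hs
  rw [Measure.sum_apply _ hs]
  simp [ENNReal.tsum_mul_right, P.tsum_coe]

theorem toMeasure_bind_map {γ : Type*} [MeasurableSpace γ] (P Q : PMF ℕ) (F : ℕ → ℕ → γ) :
    (P.bind fun i => Q.map fun j => F i j).toMeasure =
      (P.toMeasure.prod Q.toMeasure).map fun v => F v.1 v.2 := by
  have hm : Measurable fun v : ℕ × ℕ => F v.1 v.2 := measurable_of_countable _
  ext s hs
  rw [PMF.toMeasure_bind_apply _ _ _ hs, Measure.map_apply hm hs, Measure.prod_apply (hm hs),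
    lintegral_countable']
  refine tsum_congr fun i => ?_
  rw [PMF.toMeasure_apply_singleton _ _ (measurableSet_singleton _), mul_comm,
    ← PMF.toMeasure_map _ _ (measurable_of_countable _),
    Measure.map_apply (measurable_of_countable _) hs]
  rfl

theorem le_of_mem_support_inversionsLaw {n : ℕ} {p : unitInterval} {k : ℕ}
    (hk : k ∈ (inversionsLaw n p).support) : k ≤ n ^ 2 := by
  rw [inversionsLaw, PMF.mem_support_bind_iff] at hk
  obtain ⟨σ, -, hk⟩ := hk
  rw [PMF.mem_support_map_iff] at hk
  obtain ⟨y, hy, rfl⟩ := hk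
  have := (perm_of_mem_support_quicksort p _ _ hy).length_eq
  rw [List.length_ofFn] at this
  exact (inversions_le y).trans_eq (by rw [this])

theorem coe_scaledLaw (n : ℕ) (p : unitInterval) : (scaledLaw n p : Measure ℝ) =
    ((inversionsLaw n p).toMeasure).map fun k : ℕ => (k : ℝ) / ((n : ℝ) ^ 2 * (p : ℝ)) := by
  rw [PMF.toMeasure_map _ _ (measurable_of_countable _)]
  rfl

theorem ae_scaledLaw (n : ℕ) {p : unitInterval} (hp : 0 < p) :
    ∀ᵐ x ∂(scaledLaw n p : Measure ℝ), x ∈ Set.Icc (0 : ℝ) (1 / p) := by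
  have hp0 : (0 : ℝ) < p := hp
  have hI : MeasurableSet {x : ℝ | x ∈ Set.Icc (0 : ℝ) (1 / p)} := measurableSet_Icc
  rw [coe_scaledLaw, ae_map_iff (measurable_of_countable _).aemeasurable hI]
  have hsupp : ∀ᵐ k ∂(inversionsLaw n p).toMeasure, k ∈ (inversionsLaw n p).support := by
    rw [ae_iff]
    have : {k | ¬ k ∈ (inversionsLaw n p).support} = (inversionsLaw n p).supportᶜ := rfl
    rw [this, PMF.toMeasure_apply_eq_zero_iff _ (Set.to_countable _).measurableSet]
    exact disjoint_compl_right
  filter_upwards [hsupp] with k hk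
  have hk' : (k : ℝ) ≤ (n : ℝ) ^ 2 := by exact_mod_cast le_of_mem_support_inversionsLaw hk
  refine ⟨by positivity, ?_⟩
  rcases Nat.eq_zero_or_pos n with rfl | hn
  · simp [hp0.le]
  · have : (0 : ℝ) < n := by exact_mod_cast hn
    rw [div_le_div_iff₀ (by positivity) hp0]
    nlinarith

theorem combinationLaw_const (μ ν τ : Measure ℝ) [IsProbabilityMeasure μ] [IsProbabilityMeasure ν]
    [IsProbabilityMeasure τ] (a b t : ℝ) :
    combinationLaw μ ν τ (fun _ => a) (fun _ => b) (fun _ => t) =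
      (μ.prod ν).map fun v => a * v.1 + b * v.2 + t := by
  have h : μ.prod ν = (μ.prod (ν.prod τ)).map (Prod.map id Prod.fst) := by
    rw [← Measure.map_prod_map _ _ measurable_id measurable_fst, Measure.map_fst_prod]
    simp
  rw [h, Measure.map_map (by fun_prop) (by fun_prop)]
  rfl

/-- The number of inversions when the sublists have lengths `z` and `z'` and the partition has
produced `t` inversions, in terms of the scaled laws of the sublists. The coefficients are constant,
so the law `τ` is arbitrary. -/
theorem toMeasure_scaled_step (n z z' t : ℕ) {p : unitInterval} (hp : 0 < p) (τ : Measure ℝ)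
    [IsProbabilityMeasure τ] :
    ((inversionsLaw z p).bind fun i => (inversionsLaw z' p).map fun j =>
      ((i + j + t : ℕ) : ℝ) / ((n : ℝ) ^ 2 * (p : ℝ))).toMeasure =
    combinationLaw (scaledLaw z p) (scaledLaw z' p) τ (fun _ => ((z : ℝ) / n) ^ 2)
      (fun _ => ((z' : ℝ) / n) ^ 2) (fun _ => (t : ℝ) / ((n : ℝ) ^ 2 * p)) := by
  have hp0 : (p : ℝ) ≠ 0 := (show (0 : ℝ) < p from hp).ne'
  have hsc {m k : ℕ} (hk : k ∈ (inversionsLaw m p).support) :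
      ((m : ℝ) / n) ^ 2 * ((k : ℝ) / ((m : ℝ) ^ 2 * p)) = (k : ℝ) / ((n : ℝ) ^ 2 * p) := by
    -- for `m = 0` both sides vanish, since there are no inversions and division by zero gives zero
    rcases Nat.eq_zero_or_pos m with rfl | hm
    · have : k = 0 := by simpa using le_of_mem_support_inversionsLaw hk
      simp [this]
    · have : (m : ℝ) ≠ 0 := by exact_mod_cast hm.ne'
      field_simp
  rw [combinationLaw_const, coe_scaledLaw, coe_scaledLaw, Measure.map_prod_map _ _
    (measurable_of_countable _) (measurable_of_countable _), Measure.map_map (by fun_prop)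
    (measurable_of_countable _)]
  refine Eq.trans ?_ (toMeasure_bind_map _ _ fun i j : ℕ =>
    ((z : ℝ) / n) ^ 2 * ((i : ℝ) / ((z : ℝ) ^ 2 * p)) +
      ((z' : ℝ) / n) ^ 2 * ((j : ℝ) / ((z' : ℝ) ^ 2 * p)) + (t : ℝ) / ((n : ℝ) ^ 2 * p))
  congr 1
  refine bind_congr_of_mem_support _ _ _ fun i hi => ?_
  rw [← PMF.bind_pure_comp, ← PMF.bind_pure_comp]
  refine bind_congr_of_mem_support _ _ _ fun j hj => ?_
  refine congrArg PMF.pure ?_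
  beta_reduce
  rw [hsc hi, hsc hj]
  push_cast
  ring

theorem combinationLaw_sum {ι : Type*} [Countable ι] (μ ν : Measure ℝ) [IsProbabilityMeasure μ]
    [IsProbabilityMeasure ν] (w : ι → ENNReal) (τ : ι → Measure ℝ) [∀ i, SFinite (τ i)]
    {a b t : ℝ → ℝ} (ha : Measurable a) (hb : Measurable b) (ht : Measurable t) :
    combinationLaw μ ν (Measure.sum fun i => w i • τ i) a b t =
      Measure.sum fun i => w i • combinationLaw μ ν (τ i) a b t := by
  unfold combinationLaw
  rw [Measure.prod_sum_right, Measure.prod_sum_right, Measure.map_sum (by fun_prop)]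
  simp only [Measure.prod_smul_right, Measure.map_smul]

/-- The uniform law on the `s`-th of `n` intervals of equal length in `[0, 1]`. -/
def cellLaw (n s : ℕ) : Measure ℝ :=
  (n : ENNReal) • volume.restrict (Set.Ico ((s : ℝ) / n) ((s + 1 : ℝ) / n))

theorem isProbabilityMeasure_cellLaw {n : ℕ} (hn : 0 < n) (s : ℕ) :
    IsProbabilityMeasure (cellLaw n s) := by
  have hn' : (0 : ℝ) < n := by exact_mod_cast hn
  refine ⟨?_⟩
  rw [cellLaw, Measure.smul_apply, Measure.restrict_apply MeasurableSet.univ, Set.univ_inter,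
    Real.volume_Ico, smul_eq_mul, ← ENNReal.ofReal_natCast, ← ENNReal.ofReal_mul hn'.le,
    ← ENNReal.ofReal_one]
  congr 1
  field_simp
  ring

theorem uniformLaw_eq_sum (n : ℕ) :
    uniformLaw = Measure.sum fun s : Fin (n + 1) =>
      PMF.uniformOfFintype (Fin (n + 1)) s • cellLaw (n + 1) s := by
  have hn' : (0 : ℝ) < ((n + 1 : ℕ) : ℝ) := by positivity
  have h1 (s : Fin (n + 1)) : PMF.uniformOfFintype (Fin (n + 1)) s • cellLaw (n + 1) s =
      volume.restrict (Set.Ico ((s : ℝ) / (n + 1 : ℕ)) ((s + 1 : ℝ) / (n + 1 : ℕ))) := by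
    rw [cellLaw, smul_smul, PMF.uniformOfFintype_apply, Fintype.card_fin,
      ENNReal.inv_mul_cancel (by simp) (by simp), one_smul]
  simp only [h1]
  rw [← Measure.restrict_iUnion, uniformLaw, ← restrict_Ico_eq_restrict_Icc]
  · congr 1
    ext x
    simp only [Set.mem_Ico, Set.mem_iUnion, div_le_iff₀ hn', lt_div_iff₀ hn']
    constructor
    · rintro ⟨h0, h1⟩
      have hx0 : 0 ≤ x * ((n + 1 : ℕ) : ℝ) := by positivity
      refine ⟨⟨⌊x * ((n + 1 : ℕ) : ℝ)⌋₊, ?_⟩, Nat.floor_le hx0, Nat.lt_floor_add_one _⟩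
      rw [Nat.floor_lt hx0]
      nlinarith
    · rintro ⟨s, h0, h1⟩
      have hs : ((s : ℕ) : ℝ) + 1 ≤ ((n + 1 : ℕ) : ℝ) := by exact_mod_cast s.2
      have hs0 : (0 : ℝ) ≤ ((s : ℕ) : ℝ) := Nat.cast_nonneg _
      constructor <;> by_contra! hcon <;> nlinarith
  · intro s s' hss'
    rw [Function.onFun, Set.disjoint_left]
    intro x hx hx'
    simp only [Set.mem_Ico, div_le_iff₀ hn', lt_div_iff₀ hn'] at hx hx'
    have a1 : ((s : ℕ) : ℝ) < ((s' : ℕ) : ℝ) + 1 := by linarith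
    have a2 : ((s' : ℕ) : ℝ) < ((s : ℕ) : ℝ) + 1 := by linarith
    have a1' : (s : ℕ) < s' + 1 := by exact_mod_cast a1
    have a2' : (s' : ℕ) < s + 1 := by exact_mod_cast a2
    exact hss' (Fin.ext (by omega))
  · exact fun _ => measurableSet_Ico

theorem recursionLaw_eq_sum (c : ℝ) (μ : Measure ℝ) [IsProbabilityMeasure μ] (n : ℕ) :
    recursionLaw c μ = Measure.sum fun s : Fin (n + 1) =>
      PMF.uniformOfFintype (Fin (n + 1)) s • combinationLaw μ μ (cellLaw (n + 1) s)
        (leftCoeff c) (rightCoeff c) (toll c) := by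
  have (s : Fin (n + 1)) : IsProbabilityMeasure (cellLaw (n + 1) s) :=
    isProbabilityMeasure_cellLaw n.succ_pos s
  rw [recursionLaw_eq, uniformLaw_eq_sum n]
  exact combinationLaw_sum _ _ _ _ (continuous_leftCoeff c).measurable
    (continuous_rightCoeff c).measurable (continuous_toll c).measurable

theorem coe_scaledLaw_succ (n : ℕ) (p : unitInterval) : (scaledLaw (n + 1) p : Measure ℝ) =
    ((PMF.uniformOfFintype (Fin (n + 1))).bind fun s => (errorPattern p (others s)).bind fun e =>
      (inversionsLaw ((others s).filter fun x => goesLeft s e x).length p).bind fun i =>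
        (inversionsLaw ((others s).filter fun x => !goesLeft s e x).length p).map fun j =>
          ((i + j + tollCount s e (others s) : ℕ) : ℝ) /
            (((n + 1 : ℕ) : ℝ) ^ 2 * (p : ℝ))).toMeasure := by
  change ((inversionsLaw (n + 1) p).map _).toMeasure = _
  rw [inversionsLaw_succ]
  simp only [PMF.map_bind, PMF.map_comp]
  rfl

end

/-! ### The means of the sublist size and of the toll -/

noncomputable section

theorem map_leftProb_others {n : ℕ} (p : unitInterval) (s : Fin (n + 1)) :
    (others s).map (leftProb p s) =
      List.replicate s (1 - (p : ℝ)) ++ List.replicate (n - s) (p : ℝ) := by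
  have h : others s = (List.finRange n).map s.succAbove := by
    refine (sortedLT_others s).eq_of_mem_iff ?_ fun a => ?_
    · rw [← List.ofFn_eq_map, List.sortedLT_ofFn_iff]
      exact Fin.strictMono_succAbove s
    · rw [others, (List.nodup_finRange (n + 1)).mem_erase_iff]
      simp [Fin.exists_succAbove_eq_iff]
  rw [h, List.map_map]
  have hs : (s : ℕ) ≤ n := Nat.lt_succ_iff.1 s.2
  refine List.ext_getElem (by simp [hs]) fun i hi hi' => ?_
  simp only [List.getElem_map, List.getElem_finRange, Function.comp]
  rw [List.getElem_append, leftProb]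
  simp only [List.length_replicate, List.getElem_replicate]
  by_cases his : i < s
  · rw [Fin.succAbove_of_castSucc_lt _ _ (by simpa [Fin.lt_def] using his)]
    simp [Fin.lt_def, his]
  · rw [Fin.succAbove_of_le_castSucc _ _ (by simpa [Fin.le_def] using his)]
    rw [if_neg (by simp [Fin.lt_def]; omega)]
    simp [his]

theorem crossMean_replicate_append (q : ℝ) (k : ℕ) (l : List ℝ) :
    crossMean (List.replicate k q ++ l) =
      crossMean l + (1 - q) * (k * l.sum + q * (k * (k - 1) / 2)) := by
  induction k with
  | zero => simp
  | succ k ih =>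
    rw [List.replicate_succ, List.cons_append, crossMean, ih]
    simp only [List.sum_append, List.sum_replicate, nsmul_eq_mul]
    push_cast
    ring

theorem sum_others {n : ℕ} (p : unitInterval) (s : Fin (n + 1)) :
    ((others s).map (leftProb p s)).sum = s * (1 - (p : ℝ)) + (n - s) * p := by
  have hs : (s : ℕ) ≤ n := Nat.lt_succ_iff.1 s.2
  rw [map_leftProb_others]
  simp [Nat.cast_sub hs]

theorem crossMean_others {n : ℕ} (p : unitInterval) (s : Fin (n + 1)) :
    crossMean ((others s).map (leftProb p s)) = p * ((1 - p) / 2 *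
      (s * (s - 1) + (n - s) * (n - s - 1)) + p * (s * (n - s))) := by
  have hs : (s : ℕ) ≤ n := Nat.lt_succ_iff.1 s.2
  rw [map_leftProb_others, crossMean_replicate_append,
    ← List.append_nil (List.replicate (n - s) (p : ℝ)), crossMean_replicate_append]
  simp only [crossMean, List.sum_append, List.sum_replicate, nsmul_eq_mul, List.sum_nil,
    Nat.cast_sub hs]
  ring

theorem length_others {n : ℕ} (s : Fin (n + 1)) : (others s).length = n := by
  rw [others, List.length_erase_of_mem (List.mem_finRange s), List.length_finRange,
    Nat.add_sub_cancel]

/-! ### Comparison of one partition step with the distributional equation -/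

theorem abs_sq_sub_sq_le {x y : ℝ} (hx : x ∈ Set.Icc (0 : ℝ) 1) (hy : y ∈ Set.Icc (0 : ℝ) 1) :
    |x ^ 2 - y ^ 2| ≤ 2 * |x - y| := by
  rw [sq_sub_sq, abs_mul]
  refine mul_le_mul_of_nonneg_right ?_ (abs_nonneg _)
  rw [abs_of_nonneg (add_nonneg hx.1 hy.1)]
  linarith [hx.2, hy.2]

/-- `(1 - 2c) u + c` lies in `[0, 1]`. -/
theorem leftShare_mem {c u : ℝ} (hc : c ∈ Set.Icc (0 : ℝ) 1) (hu : u ∈ Set.Icc (0 : ℝ) 1) :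
    (1 - 2 * c) * u + c ∈ Set.Icc (0 : ℝ) 1 := by
  have e1 : (1 - 2 * c) * u + c = (1 - c) * u + c * (1 - u) := by ring
  have e2 : 1 - ((1 - 2 * c) * u + c) = c * u + (1 - c) * (1 - u) := by ring
  have a1 := mul_nonneg (sub_nonneg.2 hc.2) hu.1
  have a2 := mul_nonneg hc.1 (sub_nonneg.2 hu.2)
  have a3 := mul_nonneg hc.1 hu.1
  have a4 := mul_nonneg (sub_nonneg.2 hc.2) (sub_nonneg.2 hu.2)
  constructor <;> linarith

/-- The relative size of the left sublist, compared with its limit. -/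
theorem abs_share_sub_le {N s z p c u : ℝ} (hN : 0 < N) (hp : p ∈ Set.Icc (0 : ℝ) 1)
    (hu : u ∈ Set.Icc (0 : ℝ) 1) (hsu : |s / N - u| ≤ 1 / N) :
    |z / N - ((1 - 2 * c) * u + c)| ≤
      |z - (s * (1 - p) + (N - 1 - s) * p)| / N + (|p - c| + 2 / N) := by
  have e : z / N - ((1 - 2 * c) * u + c) = (z - (s * (1 - p) + (N - 1 - s) * p)) / N +
      ((p - c) * (1 - 2 * u) + ((1 - 2 * p) * (s / N - u) - p * (1 / N))) := by
    field_simp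
    ring
  have h1 : |(p - c) * (1 - 2 * u)| ≤ |p - c| := by
    rw [abs_mul]
    refine mul_le_of_le_one_right (abs_nonneg _) ?_
    rw [abs_le]
    constructor <;> linarith [hu.1, hu.2]
  have h2 : |(1 - 2 * p) * (s / N - u)| ≤ 1 / N := by
    rw [abs_mul]
    refine (mul_le_of_le_one_left (abs_nonneg _) ?_).trans hsu
    rw [abs_le]
    constructor <;> linarith [hp.1, hp.2]
  have hN' : 0 ≤ 1 / N := by positivity
  have h3 : |p * (1 / N)| ≤ 1 / N := by
    rw [abs_of_nonneg (mul_nonneg hp.1 hN')]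
    exact mul_le_of_le_one_left hN' hp.2
  have h4 : 2 / N = 1 / N + 1 / N := by ring
  rw [e]
  refine (abs_add_le _ _).trans (add_le_add ?_ ((abs_add_le _ _).trans (add_le_add h1 ?_)))
  · rw [abs_div, abs_of_pos hN]
  · rw [h4]
    exact (abs_sub _ _).trans (add_le_add h2 h3)

/-- The mean of the scaled toll, compared with its limit. -/
theorem abs_meanToll_sub_le {N s p c u : ℝ} (hN : 0 < N) (hp : p ∈ Set.Icc (0 : ℝ) 1)
    (hs0 : 0 ≤ s) (hs : s ≤ N - 1)
    (hu : u ∈ Set.Icc (0 : ℝ) 1) (hsu : |s / N - u| ≤ 1 / N) :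
    |((1 - p) / 2 * (s * (s - 1) + (N - 1 - s) * (N - 1 - s - 1)) + p * (s * (N - 1 - s))) / N ^ 2 -
      toll c u| ≤ |p - c| + 4 / N := by
  set x := s / N with hx
  set y := (N - 1 - s) / N with hy
  have hN' : 0 ≤ 1 / N := by positivity
  have hx0 : 0 ≤ x := by positivity
  have hy0 : 0 ≤ y := div_nonneg (by linarith) hN.le
  have hxy : x + y = 1 - 1 / N := by
    rw [hx, hy]; field_simp; ring
  have hx1 : x ∈ Set.Icc (0 : ℝ) 1 := ⟨hx0, by linarith⟩
  have hy1 : y ∈ Set.Icc (0 : ℝ) 1 := ⟨hy0, by linarith⟩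
  have hu' : 1 - u ∈ Set.Icc (0 : ℝ) 1 := ⟨by linarith [hu.2], by linarith [hu.1]⟩
  have hyu : |y - (1 - u)| ≤ 2 / N := by
    have e : y - (1 - u) = -(x - u) - 1 / N := by linarith
    rw [e]
    refine (abs_sub _ _).trans ?_
    rw [abs_neg, abs_of_nonneg hN']
    linarith [show 2 / N = 1 / N + 1 / N by ring]
  have b1 := abs_sq_sub_sq_le hx1 hu
  have b2 := abs_sq_sub_sq_le hy1 hu'
  have b3 : |x * y - u * (1 - u)| ≤ 3 / N := by
    have e : x * y - u * (1 - u) = (x - u) * y + u * (y - (1 - u)) := by ring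
    rw [e]
    refine (abs_add_le _ _).trans ?_
    rw [abs_mul, abs_mul, abs_of_nonneg hy0, abs_of_nonneg hu.1]
    have c1 := mul_le_of_le_one_right (abs_nonneg (x - u)) hy1.2
    have c2 := mul_le_of_le_one_left (abs_nonneg (y - (1 - u))) hu.2
    linarith [show 3 / N = 1 / N + 2 / N by ring]
  have e : ((1 - p) / 2 * (s * (s - 1) + (N - 1 - s) * (N - 1 - s - 1)) +
      p * (s * (N - 1 - s))) / N ^ 2 - toll c u =
      (p - c) * (u * (1 - u) - (u ^ 2 + (1 - u) ^ 2) / 2) +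
      ((1 - p) / 2 * ((x ^ 2 - u ^ 2) + ((y ^ 2 - (1 - u) ^ 2) - (x + y) / N)) +
        p * (x * y - u * (1 - u))) := by
    rw [hx, hy, toll]
    field_simp
    ring
  have b4 : |(p - c) * (u * (1 - u) - (u ^ 2 + (1 - u) ^ 2) / 2)| ≤ |p - c| := by
    rw [abs_mul]
    refine mul_le_of_le_one_right (abs_nonneg _) ?_
    rw [abs_le]
    constructor <;> nlinarith [hu.1, hu.2, mul_nonneg hu.1 hu'.1]
  have b5 : |(x + y) / N| ≤ 1 / N := by
    rw [abs_of_nonneg (by positivity), div_le_div_iff_of_pos_right hN]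
    linarith
  have b6 : |(x ^ 2 - u ^ 2) + ((y ^ 2 - (1 - u) ^ 2) - (x + y) / N)| ≤ 7 / N := by
    refine (abs_add_le _ _).trans ?_
    have := abs_sub (y ^ 2 - (1 - u) ^ 2) ((x + y) / N)
    have e1 : 7 / N = 7 * (1 / N) := by ring
    have e2 : 2 / N = 2 * (1 / N) := by ring
    rw [e2] at hyu
    rw [e1]
    linarith
  have b7 : |(1 - p) / 2 * ((x ^ 2 - u ^ 2) + ((y ^ 2 - (1 - u) ^ 2) - (x + y) / N))| ≤
      (1 - p) / 2 * (7 / N) := by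
    have : 0 ≤ (1 - p) / 2 := by linarith [hp.2]
    rw [abs_mul, abs_of_nonneg this]
    exact mul_le_mul_of_nonneg_left b6 this
  have b8 : |p * (x * y - u * (1 - u))| ≤ p * (3 / N) := by
    rw [abs_mul, abs_of_nonneg hp.1]
    exact mul_le_mul_of_nonneg_left b3 hp.1
  rw [e]
  refine (abs_add_le _ _).trans (add_le_add b4 ((abs_add_le _ _).trans ?_))
  have e1 : 7 / N = 7 * (1 / N) := by ring
  have e2 : 3 / N = 3 * (1 / N) := by ring
  have e3 : 4 / N = 4 * (1 / N) := by ring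
  rw [e1] at b7
  rw [e2] at b8
  rw [e3]
  nlinarith [mul_nonneg hp.1 hN']

theorem lintegral_ofReal_le_of_ae {τ : Measure ℝ} [IsProbabilityMeasure τ] {f : ℝ → ℝ} {δ : ℝ}
    (h : ∀ᵐ u ∂τ, f u ≤ δ) : ∫⁻ u, ENNReal.ofReal (f u) ∂τ ≤ ENNReal.ofReal δ := by
  refine (lintegral_mono_ae (h.mono fun u hu => ENNReal.ofReal_le_ofReal hu)).trans ?_
  simp

theorem ae_cellLaw {n s : ℕ} (hs : s ≤ n) :
    ∀ᵐ u ∂(cellLaw (n + 1) s), u ∈ Set.Icc (0 : ℝ) 1 ∧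
      |(s : ℝ) / (n + 1 : ℕ) - u| ≤ 1 / (n + 1 : ℕ) := by
  have hn' : (0 : ℝ) < ((n + 1 : ℕ) : ℝ) := by positivity
  refine Measure.ae_smul_measure ?_ _
  filter_upwards [ae_restrict_mem measurableSet_Ico] with u hu
  obtain ⟨h1, h2⟩ := hu
  have hs' : (s : ℝ) + 1 ≤ ((n + 1 : ℕ) : ℝ) := by exact_mod_cast Nat.succ_le_succ hs
  have h3 : ((s : ℝ) + 1) / ((n + 1 : ℕ) : ℝ) ≤ 1 := (div_le_one hn').2 hs'
  have h0 : (0 : ℝ) ≤ (s : ℝ) / ((n + 1 : ℕ) : ℝ) := by positivity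
  rw [add_div] at h2 h3
  refine ⟨⟨by linarith, by linarith⟩, ?_⟩
  rw [abs_le]
  constructor <;> linarith [show (0 : ℝ) ≤ 1 / ((n + 1 : ℕ) : ℝ) by positivity]

theorem tollCount_bounds (a : ℕ) {n : ℕ} (s : Fin (n + 1)) (e : Fin (n + 1) → Bool)
    (ha : a = crossInversions ((others s).filter fun x => goesLeft s e x)
      ((others s).filter fun x => !goesLeft s e x)) :
    ∃ k ≤ n, tollCount s e (others s) = k + a := by
  refine ⟨_, ?_, by rw [tollCount, ha]⟩
  have h1 := List.countP_le_length (p := fun x => decide (s < x))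
    (l := (others s).filter fun x => goesLeft s e x)
  have h2 := List.countP_le_length (p := fun x => decide (x < s))
    (l := (others s).filter fun x => !goesLeft s e x)
  have h3 : ((others s).filter fun x => goesLeft s e x).length +
      ((others s).filter fun x => !goesLeft s e x).length = n := by
    rw [← List.length_append, (List.filter_append_perm _ (others s)).length_eq, length_others]
  omega

theorem ofReal_combine {r₁ r₂ α β M δ₁ δ₂ δ₃ R : ℝ} (h1 : 0 ≤ r₁) (h2 : 0 ≤ r₂) (hα : 0 ≤ α)
    (hβ : 0 ≤ β) (hM : 0 ≤ M) (hδ₁ : 0 ≤ δ₁) (hδ₂ : 0 ≤ δ₂) (hδ₃ : 0 ≤ δ₃)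
    (h : r₁ * α + r₂ * β + M * δ₁ + M * δ₂ + δ₃ ≤ R) :
    ENNReal.ofReal r₁ * ENNReal.ofReal α + ENNReal.ofReal r₂ * ENNReal.ofReal β +
      ENNReal.ofReal M * ENNReal.ofReal δ₁ + ENNReal.ofReal M * ENNReal.ofReal δ₂ +
      ENNReal.ofReal δ₃ ≤ ENNReal.ofReal R := by
  rw [← ENNReal.ofReal_mul h1, ← ENNReal.ofReal_mul h2, ← ENNReal.ofReal_mul hM,
    ← ENNReal.ofReal_mul hM, ← ENNReal.ofReal_add (by positivity) (by positivity),
    ← ENNReal.ofReal_add (by positivity) (by positivity),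
    ← ENNReal.ofReal_add (by positivity) (by positivity),
    ← ENNReal.ofReal_add (by positivity) (by positivity)]
  exact ENNReal.ofReal_le_ofReal h

set_option maxHeartbeats 400000 in
/-- One partition step with pivot `s` and error pattern `e`: from couplings for the sublists one
gets a coupling with the right hand side of the distributional equation for `U` in the `s`-th cell.
Sublists of length less than `K` may be coupled badly, because their weight is small. -/
theorem coupledWithin_partition {c p : unitInterval} (hp : 0 < p) {μ : ProbabilityMeasure ℝ}
    (hμ : Integrable (fun x : ℝ => x) (μ : Measure ℝ)) {a D : ℝ} (ha : 0 ≤ a) (hD : 0 ≤ D) {K : ℕ}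
    (hD' : ∀ z, CoupledWithin (scaledLaw z p) μ D)
    (hK : ∀ z, K ≤ z → CoupledWithin (scaledLaw z p) μ a)
    {M N r₁ : ℝ} (hM : M = ∫ x, |x| ∂(μ : Measure ℝ)) {n : ℕ} (hN : N = ((n + 1 : ℕ) : ℝ))
    (s : Fin (n + 1)) (e : Fin (n + 1) → Bool) {z z' : List (Fin (n + 1))}
    (hz : z = (others s).filter fun x => goesLeft s e x)
    (hz' : z' = (others s).filter fun x => !goesLeft s e x)
    (hr₁ : r₁ = a * ((s / N) ^ 2 + (1 - s / N) ^ 2) + ((a + M) * (4 * |(p : ℝ) - c| + 10 / N) +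
      2 * K ^ 2 * D / N ^ 2 + 1 / (p * N) + |(p : ℝ) - c| + 4 / N)) :
    CoupledWithin
      ((inversionsLaw z.length p).bind fun i => (inversionsLaw z'.length p).map fun j =>
        ((i + j + tollCount s e (others s) : ℕ) : ℝ) / (((n + 1 : ℕ) : ℝ) ^ 2 * (p : ℝ))).toMeasure
      (combinationLaw μ μ (cellLaw (n + 1) s) (leftCoeff c) (rightCoeff c) (toll c))
      (r₁ + 4 * (a + M) / N * |z.length - ((others s).map (leftProb p s)).sum| +
        1 / (N ^ 2 * p) * |crossInversions z z' - crossMean ((others s).map (leftProb p s))|) := by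
  have hcell := isProbabilityMeasure_cellLaw n.succ_pos s
  have hp0 : (0 : ℝ) < p := hp
  have hN0 : 0 < N := by rw [hN]; positivity
  have hM0 : 0 ≤ M := by rw [hM]; exact integral_nonneg fun _ => abs_nonneg _
  have hs : (s : ℕ) ≤ n := Nat.lt_succ_iff.1 s.2
  have hnN : (n : ℝ) = N - 1 := by rw [hN]; push_cast; ring
  have hs1 : (s : ℝ) ≤ N - 1 := by rw [← hnN]; exact_mod_cast hs
  have hs0 : (0 : ℝ) ≤ (s : ℕ) := Nat.cast_nonneg _
  obtain ⟨k, hk, htoll⟩ := tollCount_bounds _ s e rfl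
  have hlen : z.length + z'.length = n := by
    have h3 := (List.filter_append_perm (goesLeft s e) (others s)).length_eq
    rw [List.length_append, length_others] at h3
    rw [hz, hz']
    exact h3
  rw [← hz, ← hz'] at htoll
  rw [toMeasure_scaled_step (n + 1) _ _ _ hp (cellLaw (n + 1) s), htoll, sum_others,
    crossMean_others, hnN, ← hN]
  have hlenR : (z'.length : ℝ) = N - 1 - z.length := by
    have : (z.length : ℝ) + z'.length = n := by exact_mod_cast hlen
    linarith
  have hZ0 : (0 : ℝ) ≤ z.length := Nat.cast_nonneg _
  have hZ0' : (0 : ℝ) ≤ z'.length := Nat.cast_nonneg _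
  set Z : ℝ := (z.length : ℝ) with hZ
  set Z' : ℝ := (z'.length : ℝ) with hZ'
  set ζ : ℝ := (s : ℝ) * (1 - (p : ℝ)) + (N - 1 - s) * p with hζ
  set T : ℝ := (1 - (p : ℝ)) / 2 * (s * (s - 1) + (N - 1 - s) * (N - 1 - s - 1)) +
    p * (s * (N - 1 - s)) with hT
  set C : ℝ := (crossInversions z z' : ℝ) with hC
  set δ : ℝ := |Z - ζ| / N + (|(p : ℝ) - c| + 2 / N) with hδ
  have hδ0 : 0 ≤ δ := by positivity
  have hshare {u : ℝ} (hu : u ∈ Set.Icc (0 : ℝ) 1) (hsu : |(s : ℝ) / N - u| ≤ 1 / N) :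
      |(Z / N) ^ 2 - leftCoeff c u| ≤ 2 * δ ∧
        |(Z' / N) ^ 2 - rightCoeff c u| ≤ 2 * (δ + 1 / N) := by
    have h := abs_share_sub_le (z := Z) (c := c) hN0 p.2 hu hsu
    have hA := leftShare_mem c.2 hu
    have hB : (2 * (c : ℝ) - 1) * u + 1 - c = 1 - ((1 - 2 * c) * u + c) := by ring
    have hB' : (2 * (c : ℝ) - 1) * u + 1 - c ∈ Set.Icc (0 : ℝ) 1 := by
      rw [hB]
      exact ⟨by linarith [hA.2], by linarith [hA.1]⟩
    have hZN : Z / N ∈ Set.Icc (0 : ℝ) 1 :=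
      ⟨by positivity, (div_le_one hN0).2 (by linarith)⟩
    have hZN' : Z' / N ∈ Set.Icc (0 : ℝ) 1 :=
      ⟨by positivity, (div_le_one hN0).2 (by linarith)⟩
    refine ⟨(abs_sq_sub_sq_le hZN hA).trans (by linarith), (abs_sq_sub_sq_le hZN' hB').trans ?_⟩
    have e1 : Z' / N - ((2 * (c : ℝ) - 1) * u + 1 - c) =
        -(Z / N - ((1 - 2 * c) * u + c)) - 1 / N := by
      rw [hlenR]; field_simp; ring
    have h2 := abs_sub (-(Z / N - ((1 - 2 * c) * u + c))) (1 / N)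
    rw [abs_neg, abs_of_nonneg (show 0 ≤ 1 / N by positivity), ← e1] at h2
    linarith
  have htollu {u : ℝ} (hu : u ∈ Set.Icc (0 : ℝ) 1) (hsu : |(s : ℝ) / N - u| ≤ 1 / N) :
      |((k + crossInversions z z' : ℕ) : ℝ) / (N ^ 2 * p) - toll c u| ≤
        1 / (p * N) + 1 / (N ^ 2 * p) * |C - p * T| + (|(p : ℝ) - c| + 4 / N) := by
    have h := abs_meanToll_sub_le (c := c) hN0 p.2 hs0 hs1 hu hsu
    rw [← hT] at h
    have e1 : ((k + crossInversions z z' : ℕ) : ℝ) / (N ^ 2 * p) - toll c u =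
        k / (N ^ 2 * p) + 1 / (N ^ 2 * p) * (C - p * T) + (T / N ^ 2 - toll c u) := by
      push_cast
      field_simp
      ring
    have hkN : (k : ℝ) ≤ N := by
      have : (k : ℝ) ≤ n := by exact_mod_cast hk
      linarith
    have h1 : |(k : ℝ) / (N ^ 2 * p)| ≤ 1 / (p * N) := by
      rw [abs_of_nonneg (by positivity), div_le_div_iff₀ (by positivity) (by positivity)]
      have : 0 ≤ (p : ℝ) * N := by positivity
      nlinarith [mul_le_mul_of_nonneg_right hkN this]
    have h2 : |1 / (N ^ 2 * p) * (C - p * T)| = 1 / (N ^ 2 * p) * |C - p * T| := by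
      rw [abs_mul, abs_of_nonneg (show 0 ≤ 1 / (N ^ 2 * (p : ℝ)) by positivity)]
    rw [e1]
    refine (abs_add_le _ _).trans (add_le_add ((abs_add_le _ _).trans (add_le_add h1 h2.le)) h)
  have hcellae := ae_cellLaw hs
  rw [← hN] at hcellae
  have hr (m : ℕ) : CoupledWithin (scaledLaw m p) μ (if K ≤ m then a else D) := by
    split_ifs with h
    · exact hK m h
    · exact hD' m
  have hr0 (m : ℕ) : 0 ≤ (if K ≤ m then a else D) := by split_ifs <;> assumption
  -- a short sublist contributes little, whatever its coupling
  have hshort (m : ℕ) : (if K ≤ m then a else D) * ((m : ℝ) / N) ^ 2 ≤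
      a * ((m : ℝ) / N) ^ 2 + K ^ 2 * D / N ^ 2 := by
    split_ifs with h
    · have : 0 ≤ K ^ 2 * D / N ^ 2 := by positivity
      linarith
    · have hm : (m : ℝ) ≤ K := by exact_mod_cast (not_le.1 h).le
      have h1 : D * ((m : ℝ) / N) ^ 2 ≤ K ^ 2 * D / N ^ 2 := by
        rw [div_pow, mul_div_assoc', div_le_div_iff_of_pos_right (by positivity), mul_comm]
        gcongr
      have : 0 ≤ a * ((m : ℝ) / N) ^ 2 := by positivity
      linarith
  refine coupledWithin_combinationLaw measurable_const measurable_const measurable_const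
    (continuous_leftCoeff c).measurable (continuous_rightCoeff c).measurable
    (continuous_toll c).measurable (fun _ => sq_nonneg _) (fun _ => sq_nonneg _)
    (hr z.length) (hr z'.length) ?_
  rw [lintegral_ofReal_abs hμ, ← hM]
  have l1 := lintegral_ofReal_le_of_ae (hcellae.mono fun u hu => (hshare hu.1 hu.2).1)
  have l2 := lintegral_ofReal_le_of_ae (hcellae.mono fun u hu => (hshare hu.1 hu.2).2)
  have l3 := lintegral_ofReal_le_of_ae (hcellae.mono fun u hu => htollu hu.1 hu.2)
  simp only [lintegral_const, measure_univ, mul_one]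
  refine (add_le_add (add_le_add (add_le_add le_rfl (mul_le_mul_right l1 _))
    (mul_le_mul_right l2 _)) l3).trans ?_
  refine ofReal_combine (hr0 _) (hr0 _) (sq_nonneg _) (sq_nonneg _) hM0 (by positivity)
    (by positivity) (by positivity) ?_
  have hx : (s : ℝ) / N ∈ Set.Icc (0 : ℝ) 1 :=
    ⟨by positivity, (div_le_one hN0).2 (by linarith)⟩
  have hx' := hshare hx (by rw [sub_self, abs_zero]; positivity)
  have hsum := leftCoeff_add_rightCoeff_le (u := (s : ℝ) / N) c.2
  have g1 := (abs_le.1 hx'.1).2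
  have g2 := (abs_le.1 hx'.2).2
  have g3 : (Z / N) ^ 2 + (Z' / N) ^ 2 ≤
      (s / N) ^ 2 + (1 - s / N) ^ 2 + (4 * δ + 2 * (1 / N)) := by linarith
  have g4 := mul_le_mul_of_nonneg_left g3 ha
  have g5 := hshort z.length
  have g6 := hshort z'.length
  rw [← hZ] at g5
  rw [← hZ'] at g6
  have e1 : (a + M) * (4 * δ + 2 * (1 / N)) =
      (a + M) * (4 * |(p : ℝ) - c| + 10 / N) + 4 * (a + M) / N * |Z - ζ| := by
    rw [hδ]; ring
  have e2 : 2 * (K : ℝ) ^ 2 * D / N ^ 2 = K ^ 2 * D / N ^ 2 + K ^ 2 * D / N ^ 2 := by ring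
  have e3 : M * (2 * δ) + M * (2 * (δ + 1 / N)) = M * (4 * δ + 2 * (1 / N)) := by ring
  rw [add_mul] at e1
  rw [mul_add a, mul_add a] at g4
  rw [hr₁, e2]
  linarith

theorem sum_sq_add_sq (N : ℝ) (m : ℕ) :
    ∑ s ∈ Finset.range m, ((s : ℝ) ^ 2 + (N - s) ^ 2) =
      m * (m - 1) * (2 * m - 1) / 3 - N * m * (m - 1) + m * N ^ 2 := by
  induction m with
  | zero => simp
  | succ m ih =>
    rw [Finset.sum_range_succ, ih]
    push_cast
    ring

theorem sum_cells_le {N : ℝ} {n : ℕ} (hN : N = ((n + 1 : ℕ) : ℝ)) :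
    ∑ s : Fin (n + 1), (((s : ℕ) / N) ^ 2 + (1 - (s : ℕ) / N) ^ 2) ≤ N * (2 / 3 + 1 / N) := by
  have hN1 : 1 ≤ N := by rw [hN]; push_cast; linarith [(Nat.cast_nonneg n : (0 : ℝ) ≤ n)]
  have hN0 : 0 < N := by linarith
  rw [Fin.sum_univ_eq_sum_range fun s : ℕ => ((s : ℝ) / N) ^ 2 + (1 - (s : ℝ) / N) ^ 2]
  have e (s : ℕ) : ((s : ℝ) / N) ^ 2 + (1 - (s : ℝ) / N) ^ 2 =
      1 / N ^ 2 * ((s : ℝ) ^ 2 + (N - s) ^ 2) := by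
    field_simp
  simp only [e]
  rw [← Finset.mul_sum, sum_sq_add_sq, ← hN]
  have e2 : 1 / N ^ 2 * (N * (N - 1) * (2 * N - 1) / 3 - N * N * (N - 1) + N * N ^ 2) =
      N * (2 / 3) + 1 / (3 * N) := by
    field_simp
    ring
  have e3 : N * (2 / 3 + 1 / N) = N * (2 / 3) + 1 := by field_simp
  rw [e2, e3]
  have : 1 / (3 * N) ≤ 1 := by
    rw [div_le_one (by positivity)]
    linarith
  linarith

/-- Averaging over the error pattern, for a fixed pivot `s`. -/
theorem coupledWithin_pivot {c p : unitInterval} (hp : 0 < p)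
    {μ : ProbabilityMeasure ℝ} (hμ : Integrable (fun x : ℝ => x) (μ : Measure ℝ))
    {a D : ℝ} (ha : 0 ≤ a) (hD : 0 ≤ D)
    {K : ℕ} (hD' : ∀ z, CoupledWithin (scaledLaw z p) μ D)
    (hK : ∀ z, K ≤ z → CoupledWithin (scaledLaw z p) μ a)
    {M N r₁ : ℝ} (hM : M = ∫ x, |x| ∂(μ : Measure ℝ)) {n : ℕ} (hN : N = ((n + 1 : ℕ) : ℝ))
    (s : Fin (n + 1))
    (hr₁ : r₁ = a * ((s / N) ^ 2 + (1 - s / N) ^ 2) + ((a + M) * (4 * |(p : ℝ) - c| + 10 / N) +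
      2 * K ^ 2 * D / N ^ 2 + 1 / (p * N) + |(p : ℝ) - c| + 4 / N)) :
    CoupledWithin
      ((errorPattern p (others s)).bind fun e =>
        (inversionsLaw ((others s).filter fun x => goesLeft s e x).length p).bind fun i =>
          (inversionsLaw ((others s).filter fun x => !goesLeft s e x).length p).map fun j =>
            ((i + j + tollCount s e (others s) : ℕ) : ℝ) /
              (((n + 1 : ℕ) : ℝ) ^ 2 * (p : ℝ))).toMeasure
      (combinationLaw μ μ (cellLaw (n + 1) s) (leftCoeff c) (rightCoeff c) (toll c))
      (r₁ + 4 * (a + M) / √N + 1 / (p * √N)) := by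
  have hp0 : (0 : ℝ) < p := hp
  have hN0 : 0 < N := by rw [hN]; positivity
  have hnN : (n : ℝ) ≤ N := by rw [hN]; push_cast; linarith
  have hM0 : 0 ≤ M := by rw [hM]; exact integral_nonneg fun _ => abs_nonneg _
  have hsq : √N * √N = N := Real.mul_self_sqrt hN0.le
  have hsq0 : 0 < √N := Real.sqrt_pos.2 hN0
  have hsqn : √(n : ℝ) ≤ √N := Real.sqrt_le_sqrt hnN
  have hdiv : √N / N = 1 / √N := by
    rw [div_eq_div_iff hN0.ne' hsq0.ne', hsq, one_mul]
  set l := (others s).map (leftProb p s) with hl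
  have hl01 : ∀ q ∈ l, 0 ≤ q ∧ q ≤ 1 := by
    intro q hq
    obtain ⟨y, -, rfl⟩ := List.mem_map.1 hq
    exact leftProb_mem p s y
  have hllen : (l.length : ℝ) = n := by rw [hl, List.length_map, length_others]
  have hr₁0 : 0 ≤ r₁ := by rw [hr₁]; positivity
  rw [← sum_pmf_smul (errorPattern p (others s)) (combinationLaw _ _ _ _ _ _)]
  refine coupledWithin_bind _ _ _ _ _ (fun e => coupledWithin_partition hp hμ ha hD hD' hK hM
    hN s e rfl rfl hr₁) ?_
  rw [tsum_errorPattern_mul p s (sortedLT_others s) (fun z x => r₁ + 4 * (a + M) / N * |z - l.sum| +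
    1 / (N ^ 2 * p) * |x - crossMean l|) (fun z x => by positivity), ← hl]
  refine ENNReal.ofReal_le_ofReal ?_
  rw [chainMean_add l (fun z _ => r₁ + 4 * (a + M) / N * |z - l.sum|)
    (fun _ x => 1 / (N ^ 2 * p) * |x - crossMean l|),
    chainMean_add l (fun _ _ => r₁) (fun z _ => 4 * (a + M) / N * |z - l.sum|), chainMean_const,
    chainMean_mul l _ (fun z _ => |z - l.sum|), chainMean_mul l _ (fun _ x => |x - crossMean l|)]
  have q1 : chainMean l (fun z _ => |z - l.sum|) ≤ √(n : ℝ) := by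
    refine chainMean_abs_le hl01 (fun z _ => z - l.sum) (Real.sqrt_nonneg _) ?_
    rw [Real.sq_sqrt (Nat.cast_nonneg _), ← hllen]
    exact chainMean_fst_sq_le hl01
  have q2 : chainMean l (fun _ x => |x - crossMean l|) ≤ n * √(n : ℝ) := by
    refine chainMean_abs_le hl01 (fun _ x => x - crossMean l) (by positivity) ?_
    rw [mul_pow, Real.sq_sqrt (Nat.cast_nonneg _), ← pow_succ, ← hllen]
    exact chainMean_snd_sq_le hl01
  refine add_le_add (add_le_add le_rfl ?_) ?_
  · have e1 : 4 * (a + M) / N * √N = 4 * (a + M) / √N := by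
      rw [div_mul_eq_mul_div, mul_div_assoc, hdiv, mul_one_div]
    rw [← e1]
    exact mul_le_mul_of_nonneg_left (q1.trans hsqn) (by positivity)
  · have e1 : 1 / (N ^ 2 * p) * (N * √N) = 1 / (p * √N) := by
      have : 1 / (N ^ 2 * (p : ℝ)) * (N * √N) = 1 / p * (√N / N) := by
        rw [div_mul_div_comm, div_mul_eq_mul_div, div_eq_div_iff (by positivity) (by positivity)]
        ring
      rw [this, hdiv, div_mul_div_comm, one_mul]
    rw [← e1]
    exact mul_le_mul_of_nonneg_left (q2.trans (by gcongr)) (by positivity)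

/-- The error terms in terms of `r = 1 / √N` and `d = |p - c|`. -/
theorem error_le {a M N r d c p E : ℝ} (ha : 0 ≤ a) (hM : 0 ≤ M) (hE : 0 ≤ E) (hN1 : 1 ≤ N)
    (hr : r = 1 / √N) (hc : 0 < c) (hp : c / 2 ≤ p) :
    a * (2 / 3 + 1 / N) + ((a + M) * (4 * d + 10 / N) + 2 * E / N ^ 2 + 1 / (p * N) + d +
      4 / N + 4 * (a + M) / √N + 1 / (p * √N)) ≤
    2 / 3 * a + (a * r + (a + M) * (14 * r + 4 * d) + (2 * E + 4 / c + 4) * r + d) := by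
  have hN0 : 0 < N := by linarith
  have hp0 : 0 < p := lt_of_lt_of_le (by positivity) hp
  have hsq : √N * √N = N := Real.mul_self_sqrt hN0.le
  have hsq0 : 0 < √N := Real.sqrt_pos.2 hN0
  have hr0 : 0 ≤ r := by rw [hr]; positivity
  have hrr : 1 / N = r * r := by rw [hr, div_mul_div_comm, one_mul, hsq]
  have hr1 : r ≤ 1 := by
    rw [hr, div_le_one hsq0, Real.one_le_sqrt]
    exact hN1
  have hNr : 1 / N ≤ r := by rw [hrr]; exact mul_le_of_le_one_left hr0 hr1
  have hNr2 : 1 / N ^ 2 ≤ r := by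
    have : 1 / N ^ 2 = (1 / N) * (1 / N) := by rw [div_mul_div_comm, one_mul, sq]
    rw [this]
    exact (mul_le_of_le_one_left (by positivity) (hNr.trans hr1)).trans hNr
  have hpr : 1 / p ≤ 2 / c := by
    rw [div_le_div_iff₀ hp0 hc]; linarith
  have k1 := mul_le_mul_of_nonneg_left hNr ha
  have k2 := mul_le_mul_of_nonneg_left hNr (add_nonneg ha hM)
  have k3 := mul_le_mul_of_nonneg_left hNr2 hE
  have k4 : 1 / p * (1 / N) ≤ 2 / c * r := by gcongr
  have k5 : 1 / p * r ≤ 2 / c * r := by gcongr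
  have e1 : 2 * E / N ^ 2 = 2 * (E * (1 / N ^ 2)) := by ring
  have e2 : 1 / (p * N) = 1 / p * (1 / N) := by rw [div_mul_div_comm, one_mul]
  have e3 : (a + M) * (4 * d + 10 / N) = (a + M) * (4 * d) + 10 * ((a + M) * (1 / N)) := by ring
  have e4 : 4 / N = 4 * (1 / N) := by ring
  have e5 : 4 / c = 2 / c + 2 / c := by ring
  have e6 : 4 * (a + M) / √N = 4 * ((a + M) * r) := by rw [hr]; ring
  have e7 : 1 / (p * √N) = 1 / p * r := by rw [hr, div_mul_div_comm, one_mul]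
  rw [e1, e2, e3, e4, e5, e6, e7]
  linarith

/-- If the position of the pivot costs `a * ((s / N) ^ 2 + (1 - s / N) ^ 2) + W`, a uniform position
costs about `2 / 3 * a + W`. -/
theorem coupledWithin_bind_uniform {n : ℕ} {f : Fin (n + 1) → PMF ℝ} {ν : Fin (n + 1) → Measure ℝ}
    {a W N : ℝ} (ha : 0 ≤ a) (hW : 0 ≤ W) (hN : N = ((n + 1 : ℕ) : ℝ))
    (h : ∀ s : Fin (n + 1), CoupledWithin (f s).toMeasure (ν s)
      (a * (((s : ℕ) / N) ^ 2 + (1 - (s : ℕ) / N) ^ 2) + W)) :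
    CoupledWithin ((PMF.uniformOfFintype (Fin (n + 1))).bind f).toMeasure
      (Measure.sum fun s => PMF.uniformOfFintype (Fin (n + 1)) s • ν s)
      (a * (2 / 3 + 1 / N) + W) := by
  have hN0 : 0 < N := by rw [hN]; positivity
  refine coupledWithin_bind _ f ν _ _ h ?_
  rw [tsum_fintype]
  simp only [PMF.uniformOfFintype_apply, Fintype.card_fin]
  rw [← Finset.mul_sum, ← ENNReal.ofReal_sum_of_nonneg (fun s _ => by positivity)]
  have hNe : ((n + 1 : ℕ) : ENNReal)⁻¹ = ENNReal.ofReal (1 / N) := by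
    rw [hN, one_div, ENNReal.ofReal_inv_of_pos (by positivity), ENNReal.ofReal_natCast]
  rw [hNe, ← ENNReal.ofReal_mul (by positivity)]
  refine ENNReal.ofReal_le_ofReal ?_
  rw [Finset.sum_add_distrib, ← Finset.mul_sum, Finset.sum_const, Finset.card_univ,
    Fintype.card_fin, nsmul_eq_mul, ← hN]
  have hcells := mul_le_mul_of_nonneg_left (sum_cells_le hN) ha
  have : 1 / N * (a * (N * (2 / 3 + 1 / N)) + N * W) = a * (2 / 3 + 1 / N) + W := by
    field_simp
  rw [← this]
  exact mul_le_mul_of_nonneg_left (add_le_add hcells le_rfl) (by positivity)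

/-- The contraction up to a small error, for lists of length `N = n + 1`. -/
theorem coupledWithin_scaledLaw_succ {c p : unitInterval} (hc : 0 < c) (hp : (c : ℝ) / 2 ≤ p)
    {μ : ProbabilityMeasure ℝ} (hμ : IsFiniteMeanSolution c μ) {a D : ℝ} (ha : 0 ≤ a) (hD : 0 ≤ D)
    {K : ℕ} (hD' : ∀ z, CoupledWithin (scaledLaw z p) μ D)
    (hK : ∀ z, K ≤ z → CoupledWithin (scaledLaw z p) μ a)
    {M N r d : ℝ} (hM : M = ∫ x, |x| ∂(μ : Measure ℝ)) {n : ℕ} (hN : N = ((n + 1 : ℕ) : ℝ))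
    (hr : r = 1 / √N) (hd : d = |(p : ℝ) - c|) :
    CoupledWithin (scaledLaw (n + 1) p) μ (2 / 3 * a + (a * r + (a + M) * (14 * r + 4 * d) +
      (2 * (K ^ 2 * D) + 4 / c + 4) * r + d)) := by
  have hc0 : (0 : ℝ) < c := hc
  have hp0 : (0 : ℝ) < p := lt_of_lt_of_le (by positivity) hp
  have hN1 : 1 ≤ N := by rw [hN]; push_cast; linarith [(Nat.cast_nonneg n : (0 : ℝ) ≤ n)]
  have hM0 : 0 ≤ M := by rw [hM]; exact integral_nonneg fun _ => abs_nonneg _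
  have hd0 : 0 ≤ d := by rw [hd]; exact abs_nonneg _
  refine CoupledWithin.mono ?_
    (error_le (E := (K : ℝ) ^ 2 * D) ha hM0 (by positivity) hN1 hr hc0 hp)
  obtain ⟨W, hW⟩ : ∃ W, W = (a + M) * (4 * d + 10 / N) + 2 * (K ^ 2 * D) / N ^ 2 + 1 / (p * N) + d +
    4 / N + 4 * (a + M) / √N + 1 / (p * √N) := ⟨_, rfl⟩
  have hW0 : 0 ≤ W := by rw [hW]; positivity
  rw [← hW]
  have hrec : (μ : Measure ℝ) = _ := hμ.2.symm.trans (recursionLaw_eq_sum c (μ : Measure ℝ) n)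
  have key := coupledWithin_bind_uniform ha hW0 hN fun s =>
    (coupledWithin_pivot (c := c) (p := p) hp0 hμ.1 ha hD hD' hK hM hN s rfl).mono
      (le_of_eq (by rw [hW, hd]; ring))
  rw [← hrec] at key
  rw [coe_scaledLaw_succ]
  exact key

/-! ### Convergence -/

/-- If the cost `a` is eventually attained, then so is `5 / 6 * a`; the slack `1 / 6 * a` over the
contraction factor `2 / 3` absorbs the error terms. -/
theorem eventually_coupledWithin {c : unitInterval} (hc : 0 < c) {μ : ProbabilityMeasure ℝ}
    (hμ : IsFiniteMeanSolution c μ) {ε : ℝ} (hε : 0 < ε) :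
    ∀ᶠ np : ℕ × unitInterval in atTop ×ˢ 𝓝 c, CoupledWithin (scaledLaw np.1 np.2) μ ε := by
  have hc0 : (0 : ℝ) < c := hc
  set M := ∫ x, |x| ∂(μ : Measure ℝ) with hM
  have hM0 : 0 ≤ M := integral_nonneg fun _ => abs_nonneg _
  set D := 2 / (c : ℝ) + M with hD
  have hDpos : 0 < D := by positivity
  have hnear : ∀ᶠ p : unitInterval in 𝓝 c, (c : ℝ) / 2 ≤ p := by
    have : Tendsto (fun p : unitInterval => (p : ℝ)) (𝓝 c) (𝓝 (c : ℝ)) :=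
      continuous_subtype_val.tendsto c
    exact (this.eventually_const_lt (half_lt_self hc0)).mono fun p hp => hp.le
  have hbound {p : unitInterval} (hp : (c : ℝ) / 2 ≤ p) (z : ℕ) :
      CoupledWithin (scaledLaw z p) μ D := by
    have hp0 : (0 : ℝ) < p := lt_of_lt_of_le (by positivity) hp
    have hae : ∀ᵐ x ∂(scaledLaw z p : Measure ℝ), |x| ≤ 2 / (c : ℝ) := by
      filter_upwards [ae_scaledLaw z (p := p) hp0] with x hx
      rw [abs_of_nonneg hx.1]
      refine hx.2.trans ?_
      rw [div_le_div_iff₀ hp0 hc0]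
      linarith
    have hint : Integrable (fun x : ℝ => x) (scaledLaw z p : Measure ℝ) :=
      Integrable.of_bound measurable_id.aestronglyMeasurable (2 / (c : ℝ)) hae
    refine (coupledWithin_of_integrable hint hμ.1).mono (add_le_add ?_ le_rfl)
    calc ∫ x, |x| ∂(scaledLaw z p : Measure ℝ)
        ≤ ∫ _, 2 / (c : ℝ) ∂(scaledLaw z p : Measure ℝ) :=
          integral_mono_ae hint.abs (integrable_const _) hae
      _ = 2 / (c : ℝ) := by simp
  -- the error terms vanish in the limit
  have hr : Tendsto (fun np : ℕ × unitInterval => 1 / √(np.1 : ℝ)) (atTop ×ˢ 𝓝 c) (𝓝 0) := by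
    have : Tendsto (fun n : ℕ => 1 / √(n : ℝ)) atTop (𝓝 0) :=
      (tendsto_const_nhds (x := (1 : ℝ))).div_atTop
        (Real.tendsto_sqrt_atTop.comp tendsto_natCast_atTop_atTop)
    exact this.comp tendsto_fst
  have hd : Tendsto (fun np : ℕ × unitInterval => |(np.2 : ℝ) - c|) (atTop ×ˢ 𝓝 c) (𝓝 0) := by
    have h1 : Tendsto (fun p : unitInterval => |(p : ℝ) - c|) (𝓝 c) (𝓝 |(c : ℝ) - c|) :=
      (Continuous.tendsto (by fun_prop) c)
    rw [sub_self, abs_zero] at h1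
    exact h1.comp tendsto_snd
  have key (k : ℕ) : ∀ᶠ np : ℕ × unitInterval in atTop ×ˢ 𝓝 c,
      CoupledWithin (scaledLaw np.1 np.2) μ ((5 / 6) ^ k * D) := by
    induction k with
    | zero =>
      filter_upwards [tendsto_snd.eventually hnear] with np hnp
      simpa using hbound hnp np.1
    | succ k ih =>
      set a := (5 / 6) ^ k * D with ha
      have ha0 : 0 < a := by positivity
      obtain ⟨A, hA, B, hB, hAB⟩ := eventually_prod_iff.1 ih
      obtain ⟨K, hK⟩ := eventually_atTop.1 hA
      have hE : Tendsto (fun np : ℕ × unitInterval => a * (1 / √(np.1 : ℝ)) +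
          (a + M) * (14 * (1 / √(np.1 : ℝ)) + 4 * |(np.2 : ℝ) - c|) +
          (2 * (K ^ 2 * D) + 4 / c + 4) * (1 / √(np.1 : ℝ)) + |(np.2 : ℝ) - c|) (atTop ×ˢ 𝓝 c)
          (𝓝 (a * 0 + (a + M) * (14 * 0 + 4 * 0) + (2 * (K ^ 2 * D) + 4 / c + 4) * 0 + 0)) :=
        (((hr.const_mul a).add (((hr.const_mul 14).add (hd.const_mul 4)).const_mul (a + M))).add
          (hr.const_mul _)).add hd
      simp only [mul_zero, add_zero] at hE
      filter_upwards [tendsto_snd.eventually hnear, tendsto_snd.eventually hB,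
        tendsto_fst.eventually (eventually_ge_atTop 1),
        hE.eventually_le_const (show 0 < a / 6 by positivity)] with np h1 h2 h3 h4
      obtain ⟨n, p⟩ := np
      obtain ⟨m, rfl⟩ := Nat.exists_eq_add_of_le' h3
      refine (coupledWithin_scaledLaw_succ hc h1 hμ ha0.le hDpos.le (hbound h1)
        (fun z hz => hAB (hK z hz) h2) hM rfl rfl rfl).mono ?_
      have e : (5 / 6 : ℝ) ^ (k + 1) * D = 2 / 3 * a + a / 6 := by
        rw [ha]; ring
      rw [e]
      exact add_le_add le_rfl h4
  have hlim : Tendsto (fun k : ℕ => (5 / 6 : ℝ) ^ k * D) atTop (𝓝 (0 * D)) :=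
    (tendsto_pow_atTop_nhds_zero_of_lt_one (by norm_num) (by norm_num)).mul_const D
  rw [zero_mul] at hlim
  obtain ⟨k, hk⟩ := (hlim.eventually_lt_const hε).exists
  exact (key k).mono fun np h => h.mono hk.le

end
end NoisyQuicksort

theorem theorem1 (c : unitInterval) (hc : 0 < c) :
    ∃ μ : ProbabilityMeasure ℝ,
      NoisyQuicksort.IsFiniteMeanSolution c μ ∧
      (∀ ν : ProbabilityMeasure ℝ, NoisyQuicksort.IsFiniteMeanSolution c ν → ν = μ) ∧
      Tendsto (fun np : ℕ × unitInterval => NoisyQuicksort.scaledLaw np.1 np.2)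
        (atTop ×ˢ 𝓝 c) (𝓝 μ) ∧
      Tendsto (fun np : ℕ × unitInterval => NoisyQuicksort.wassersteinDist
          (NoisyQuicksort.scaledLaw np.1 np.2 : Measure ℝ) (μ : Measure ℝ))
        (atTop ×ˢ 𝓝 c) (𝓝 0) ∧
      ∫ x, x ∂(μ : Measure ℝ) = (2 - (c : ℝ)) / (2 * (1 + 2 * (c : ℝ) - 2 * (c : ℝ) ^ 2)) ∧
      MemLp (fun x : ℝ => x) 2 (μ : Measure ℝ) ∧
      variance (fun x : ℝ => x) (μ : Measure ℝ) =
        (1 - (c : ℝ)) ^ 2 * (1 - 2 * (c : ℝ)) ^ 2 /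
          (4 * (1 + 2 * (c : ℝ) - 2 * (c : ℝ) ^ 2) ^ 2 *
            (3 + 6 * (c : ℝ) - 8 * (c : ℝ) ^ 2 + 4 * (c : ℝ) ^ 3 - 2 * (c : ℝ) ^ 4)) := by
  obtain ⟨μ, hae, hfix⟩ := NoisyQuicksort.exists_solution (c := c) hc c.2.2
  have hrec : NoisyQuicksort.recursionLaw c (μ : Measure ℝ) = μ := congrArg Subtype.val hfix
  have hL : MemLp (fun x : ℝ => x) 2 (μ : Measure ℝ) := by
    refine MemLp.of_bound measurable_id.aestronglyMeasurable (2 / (c : ℝ)) ?_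
    filter_upwards [hae] with x hx
    rw [Real.norm_eq_abs, abs_of_nonneg hx.1]
    exact hx.2
  have h1 : Integrable (fun x : ℝ => x) (μ : Measure ℝ) := hL.integrable one_le_two
  have h2 : Integrable (fun x : ℝ => x ^ 2) (μ : Measure ℝ) := hL.integrable_sq
  have hsol : NoisyQuicksort.IsFiniteMeanSolution c μ := ⟨h1, hrec⟩
  refine ⟨μ, hsol, fun ν hν => NoisyQuicksort.isFiniteMeanSolution_unique c.2 hν hsol,
    NoisyQuicksort.tendsto_of_eventually_coupledWithin fun ε hε =>
      NoisyQuicksort.eventually_coupledWithin hc hsol hε,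
    NoisyQuicksort.tendsto_wassersteinDist fun ε hε =>
      NoisyQuicksort.eventually_coupledWithin hc hsol hε,
    NoisyQuicksort.integral_eq_of_recursionLaw_eq c.2 h1 hrec, hL, ?_⟩
  rw [variance_eq_sub hL]
  exact NoisyQuicksort.integral_sq_eq_of_recursionLaw_eq c.2 h1 h2 hrec
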